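/- For $d\in\{0,1,2\}^2$ let $f_d:\mathbb{R}^2\to\mathbb{R}^2$, $f_d(x)=\frac{x+d}{3}$. For a nonempty set $\mathcal{D}\subset\{0,1,2\}^2$ let $K(3,\mathcal{D})$ denote the fractal square of order $3$ with digit set $\mathcal{D}$, i.e. the unique nonempty compact set $K\subset\mathbb{R}^2$ with $K=\bigcup_{d\in\mathcal{D}}f_d(K)$. Let $K_j=K(3,\mathcal{D}_j)$ for $4\le j\le 7$, where $$\mathcal{D}_4=\{(0,0),(1,0),(2,0),(0,2),(1,2)\},\qquad \mathcal{D}_5=\{(0,0),(1,0),(2,0),(0,2),(2,2)\},$$ $$\mathcal{D}_6=\{(0,0),(1,1),(2,2),(1,0),(0,2)\},\qquad \mathcal{D}_7=\{(0,0),(1,0),(2,0),(0,2),(2,1)\}.$$ Theorem. Let $\mathcal{D}\subset\{0,1,2\}^2$ with $\#\mathcal{D}=5$. If $K(3,\mathcal{D})$ has both a connected component that is a single point and a connected component that is a nondegenerate line segment, then $K(3,\mathcal{D})$ is homeomorphic to $K_j$ for some $j\in\{4,5,6,7\}$. Moreover, there are at most $8$ topological equivalence classes (classes up to homeomorphism)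 among all the fractal squares $K(3,\mathcal{D})$ with $\#\mathcal{D}=5$; that is, $\chi(5)\le 8$, where $\chi(q)$ denotes the number of topological equivalence classes in the family of all $K(3,\mathcal{D})$ with $\#\mathcal{D}=q$. -/

import Mathlib

open Set Topology TopologicalSpace Metric

noncomputable section

/-- The Euclidean plane. -/
abbrev Plane : Type := EuclideanSpace ℝ (Fin 2)

/-- The similitude `f_d(x) = (x + d) / N` attached to a digit `d ∈ {0, …, N-1}²`. -/
def digitMap (N : ℕ) (d : Fin N × Fin N) (x : Plane) : Plane :=
  (N : ℝ)⁻¹ • (x + !₂[((d.1 : ℕ) : ℝ), ((d.2 : ℕ) : ℝ)])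

/-- `K` is a nonempty compact set with `K = ⋃_{d ∈ D} f_d(K)`. -/
structure IsFractalSquare (N : ℕ) (D : Finset (Fin N × Fin N)) (K : Set Plane) : Prop where
  nonempty : K.Nonempty
  isCompact : IsCompact K
  eq_iUnion : K = ⋃ d ∈ D, digitMap N d '' K

theorem lipschitzWith_digitMap (N : ℕ) (d : Fin N × Fin N) :
    LipschitzWith (N : NNReal)⁻¹ (digitMap N d) := by
  refine LipschitzWith.of_dist_le_mul fun x y => ?_
  simp [digitMap, dist_smul₀]

/-- The Hutchinson map `X ↦ ⋃_{d ∈ D} f_d(X)` on nonempty compact sets. -/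
def hutchinson (N : ℕ) (D : Finset (Fin N × Fin N)) (hD : D.Nonempty)
    (X : NonemptyCompacts Plane) : NonemptyCompacts Plane where
  carrier := ⋃ d ∈ D, digitMap N d '' (X : Set Plane)
  isCompact' := D.isCompact_biUnion fun d _ =>
    X.isCompact.image (lipschitzWith_digitMap N d).continuous
  nonempty' := by
    obtain ⟨d, hd⟩ := hD
    exact ((X.nonempty.image (digitMap N d)).mono (Set.subset_biUnion_of_mem
      (u := fun d => digitMap N d '' (X : Set Plane)) (Finset.mem_coe.2 hd)))

theorem contractingWith_hutchinson (N : ℕ) (hN : 2 ≤ N) (D : Finset (Fin N × Fin N))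
    (hD : D.Nonempty) : ContractingWith (N : NNReal)⁻¹ (hutchinson N D hD) := by
  refine ⟨inv_lt_one_of_one_lt₀ (by exact_mod_cast hN), fun X Y => ?_⟩
  change hausdorffEDist (⋃ d ∈ D, digitMap N d '' (X : Set Plane))
    (⋃ d ∈ D, digitMap N d '' (Y : Set Plane)) ≤ _ * hausdorffEDist (X : Set Plane) Y
  have key : ∀ (d : Fin N × Fin N) (A B : NonemptyCompacts Plane), ∀ x ∈ digitMap N d '' (A : Set Plane),
      infEDist x (digitMap N d '' (B : Set Plane)) ≤
        ((N : NNReal)⁻¹ : NNReal) * hausdorffEDist (A : Set Plane) B := by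
    rintro d A B _ ⟨a, ha, rfl⟩
    obtain ⟨b, hb, hab⟩ := B.isCompact.exists_infEDist_eq_edist B.nonempty a
    refine (infEDist_le_edist_of_mem (mem_image_of_mem _ hb)).trans
      ((lipschitzWith_digitMap N d a b).trans ?_)
    rw [← hab]
    gcongr
    exact infEDist_le_hausdorffEDist_of_mem ha
  refine hausdorffEDist_iUnion_le.trans (iSup_le fun d =>
    hausdorffEDist_iUnion_le.trans (iSup_le fun _ => ?_))
  refine hausdorffEDist_le_of_infEDist (key d X Y) ?_
  rw [hausdorffEDist_comm]
  exact key d Y X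

/-- Existence and uniqueness of the fractal square of order `N` with digit set `D`. -/
theorem existsUnique_isFractalSquare (N : ℕ) (hN : 2 ≤ N) (D : Finset (Fin N × Fin N))
    (hD : D.Nonempty) : ∃! K : Set Plane, IsFractalSquare N D K := by
  have hc := contractingWith_hutchinson N hN D hD
  haveI : Nonempty (NonemptyCompacts Plane) := ⟨⟨⟨{0}, isCompact_singleton⟩, singleton_nonempty 0⟩⟩
  have hfix := hc.fixedPoint_isFixedPt
  refine ⟨(ContractingWith.fixedPoint _ hc : NonemptyCompacts Plane),
    ⟨NonemptyCompacts.nonempty _, NonemptyCompacts.isCompact _,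
      (congrArg (fun X : NonemptyCompacts Plane => (X : Set Plane)) hfix).symm⟩, fun K hK => ?_⟩
  have h : Function.IsFixedPt (hutchinson N D hD) ⟨⟨K, hK.isCompact⟩, hK.nonempty⟩ :=
    SetLike.coe_injective hK.eq_iUnion.symm
  exact congrArg (fun X : NonemptyCompacts Plane => (X : Set Plane)) (hc.fixedPoint_unique h)

/-- The fractal square `K(N, D)`. For `2 ≤ N` and nonempty `D` exactly one set satisfies
`IsFractalSquare N D`, and this union is that set. -/
def fractalSquare (N : ℕ) (D : Finset (Fin N × Fin N)) : Set Plane :=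
  ⋃₀ {K | IsFractalSquare N D K}

theorem IsFractalSquare.eq_fractalSquare {N : ℕ} (hN : 2 ≤ N) {D : Finset (Fin N × Fin N)}
    (hD : D.Nonempty) {K : Set Plane} (hK : IsFractalSquare N D K) : fractalSquare N D = K := by
  have h : {K | IsFractalSquare N D K} = {K} :=
    Set.eq_singleton_iff_unique_mem.2
      ⟨hK, fun _ hL => (existsUnique_isFractalSquare N hN D hD).unique hL hK⟩
  rw [fractalSquare, h, sUnion_singleton]

theorem isFractalSquare_fractalSquare (N : ℕ) (hN : 2 ≤ N) (D : Finset (Fin N × Fin N))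
    (hD : D.Nonempty) : IsFractalSquare N D (fractalSquare N D) := by
  obtain ⟨K, hK, -⟩ := existsUnique_isFractalSquare N hN D hD
  rwa [hK.eq_fractalSquare hN hD]

/-- Some connected component of `K` is a single point. -/
def HasPointComponent (K : Set Plane) : Prop :=
  ∃ x ∈ K, connectedComponentIn K x = {x}

/-- Some connected component of `K` is a (nondegenerate) line segment. -/
def HasSegmentComponent (K : Set Plane) : Prop :=
  ∃ x ∈ K, ∃ a b : Plane, a ≠ b ∧ connectedComponentIn K x = segment ℝ a b

/-- The family of all fractal squares `K(3, D)` with `#D = q`. -/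
def orderThreeFamily (q : ℕ) : Set (Set Plane) :=
  {K | ∃ D : Finset (Fin 3 × Fin 3), D.card = q ∧ K = fractalSquare 3 D}

/-- Topological equivalence (being homeomorphic) of the members of a family of plane sets. -/
def topEquiv (F : Set (Set Plane)) : Setoid F where
  r K L := Nonempty ((K : Set Plane) ≃ₜ (L : Set Plane))
  iseqv :=
    { refl := fun _ => ⟨Homeomorph.refl _⟩
      symm := fun ⟨h⟩ => ⟨h.symm⟩
      trans := fun ⟨h⟩ ⟨k⟩ => ⟨h.trans k⟩ }

/-- `χ(q)`: the number of topological equivalence classes of fractal squares `K(3, D)` with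
`#D = q`, as an extended natural number. -/
def chi (q : ℕ) : ℕ∞ := ENat.card (Quotient (topEquiv (orderThreeFamily q)))

def D4 : Finset (Fin 3 × Fin 3) := {(0, 0), (1, 0), (2, 0), (0, 2), (1, 2)}
def D5 : Finset (Fin 3 × Fin 3) := {(0, 0), (1, 0), (2, 0), (0, 2), (2, 2)}
def D6 : Finset (Fin 3 × Fin 3) := {(0, 0), (1, 1), (2, 2), (1, 0), (0, 2)}
def D7 : Finset (Fin 3 × Fin 3) := {(0, 0), (1, 0), (2, 0), (0, 2), (2, 1)}

end

/-!
Call a compact space decorated by a space `I` if its components are points and copies of `I`, only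
finitely many components exceed any given size, and every nonempty open set contains two copies.
Such a space splits into one copy of `I` and a null sequence of clopen pieces which are again
decorated. As copies are approached everywhere, the pieces can be arranged to cluster at a
prescribed sequence of points of the copy; iterating gives a tree of clopen sets whose combinatorics
do not depend on the space, so all spaces decorated by `I` are homeomorphic.

To find the components of a fractal square, label its cells of a given size by integers so that
touching cells get the same label: if the labels follow a linear form up to bounded error, then
passing to smaller cells shows that this form is constant on components. Touching is controlled by
finitely many relative positions, so such a labelling is a finite certificate. If the height is
constant on components and there is exactly one full row, the components are points and horizontal
segments, and the fractal square is decorated by the unit interval. If the components are points,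
it is decorated by a point and hence a Cantor set. Up to integer affine maps this leaves five
connected fractal squares and that of `D6`.
-/

/-- A splitting of `Q`: an embedded copy `γ` of `I` together with disjoint nonempty clopen sets
`q k` that fill up the rest of `Q`, shrink, and accumulate on the copy at the points `γ (τ k)`. -/
structure IsSplitting {I X : Type*} [MetricSpace I] [MetricSpace X] (τ : ℕ → I) (Q : Set X)
    (γ : I → X) (q : ℕ → Set X) : Prop where
  continuous : Continuous γ
  injective : Function.Injective γ
  isClopen : ∀ k, IsClopen (q k)
  nonempty : ∀ k, (q k).Nonempty
  eq_union : Q = range γ ∪ ⋃ k, q k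
  disjoint_range : ∀ k, Disjoint (range γ) (q k)
  pairwise_disjoint : Pairwise (Function.onFun Disjoint q)
  cluster : ∀ ε > 0, ∀ᶠ k in Filter.atTop, q k ⊆ ball (γ (τ k)) ε

/-- An infinite branch of the tree of words, where `k :: w` is the `k`-th child of `w`. -/
def IsBranch (w : ℕ → List ℕ) : Prop :=
  w 0 = [] ∧ ∀ n, ∃ k, w (n + 1) = k :: w n

/-- A hierarchical decomposition of `X` along copies of `I`: the clopen sets `Q w` split into a copy
`γ w` and the children `Q (k :: w)`, attached according to the same sequence `τ` at every node, and
shrink to points along the branches. -/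
structure DecorationTree (I X : Type*) [MetricSpace I] [MetricSpace X] (τ : ℕ → I) where
  Q : List ℕ → Set X
  γ : List ℕ → I → X
  nil_eq : Q [] = univ
  splitting : ∀ w, IsSplitting τ (Q w) (γ w) fun k => Q (k :: w)
  diam_lt : ∀ w, IsBranch w → ∀ ε > 0, ∃ n, diam (Q (w n)) < ε

theorem IsBranch.length_eq {w : ℕ → List ℕ} (hw : IsBranch w) (n : ℕ) : (w n).length = n := by
  induction n with
  | zero => simp [hw.1]
  | succ n ih =>
    obtain ⟨k, hk⟩ := hw.2 n
    simp [hk, ih]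

namespace IsSplitting

variable {I X : Type*} [MetricSpace I] [MetricSpace X] {τ : ℕ → I} {Q : Set X} {γ : I → X}
  {q : ℕ → Set X}

theorem range_subset (h : IsSplitting τ Q γ q) : range γ ⊆ Q :=
  h.eq_union ▸ subset_union_left

theorem child_subset (h : IsSplitting τ Q γ q) (k : ℕ) : q k ⊆ Q :=
  h.eq_union ▸ (subset_iUnion q k).trans subset_union_right

theorem exists_mem_child (h : IsSplitting τ Q γ q) {x : X} (hx : x ∈ Q) (hγ : x ∉ range γ) :
    ∃ k, x ∈ q k :=
  mem_iUnion.1 ((h.eq_union ▸ hx : x ∈ range γ ∪ ⋃ k, q k).resolve_left hγ)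

theorem eq_of_mem_child (h : IsSplitting τ Q γ q) {x : X} {k l : ℕ} (hk : x ∈ q k)
    (hl : x ∈ q l) : k = l :=
  not_not.1 fun hkl => disjoint_left.1 (h.pairwise_disjoint hkl) hk hl

theorem notMem_child (h : IsSplitting τ Q γ q) (t : I) (k : ℕ) : γ t ∉ q k :=
  disjoint_left.1 (h.disjoint_range k) (mem_range_self t)

theorem continuousAt_of_forall_mem_child [CompactSpace I] (h : IsSplitting τ Q γ q)
    (hQ : IsClopen Q) {c : X → I} (hγ : ∀ t, c (γ t) = t) (hq : ∀ k, ∀ x ∈ q k, c x = τ k)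
    (t : I) : ContinuousAt c (γ t) := by
  -- `γ ∘ c` moves the points of all but finitely many children by less than `ε`.
  rw [((h.continuous.isClosedEmbedding h.injective).isInducing).continuousAt_iff,
    Metric.continuousAt_iff']
  intro ε hε
  obtain ⟨N, hN⟩ := Filter.eventually_atTop.1 (h.cluster (ε / 2) (half_pos hε))
  have notMem_early : ∀ᶠ y in 𝓝 (γ t), ∀ k ∈ Finset.range N, y ∉ q k :=
    (Filter.eventually_all_finset _).2 fun k _ =>
      (h.isClopen k).compl.isOpen.mem_nhds (h.notMem_child t k)
  filter_upwards [notMem_early, hQ.isOpen.mem_nhds (h.range_subset (mem_range_self t)),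
    ball_mem_nhds _ (half_pos hε)] with y hy hyQ hyt
  rw [mem_ball] at hyt
  rw [Function.comp_apply, Function.comp_apply, hγ]
  by_cases hyγ : y ∈ range γ
  · obtain ⟨s, rfl⟩ := hyγ
    rw [hγ]
    linarith
  · obtain ⟨k, hk⟩ := h.exists_mem_child hyQ hyγ
    have hNk : N ≤ k := not_lt.1 fun hkN => hy k (Finset.mem_range.2 hkN) hk
    have hyk : dist y (γ (τ k)) < ε / 2 := hN k hNk hk
    rw [hq k y hk]
    linarith [dist_triangle_left (γ (τ k)) (γ t) y]

theorem continuous_of_forall_mem_child [CompactSpace I] (h : IsSplitting τ Q γ q)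
    (hQ : IsClopen Q) {c : X → I} (hγ : ∀ t, c (γ t) = t) (hq : ∀ k, ∀ x ∈ q k, c x = τ k)
    (hout : ∀ x ∉ Q, c x = τ 0) : Continuous c := by
  have continuousAt_of_const {s : Set X} {t : I} (hs : IsOpen s) (ht : ∀ y ∈ s, c y = t) {x : X}
      (hx : x ∈ s) : ContinuousAt c x :=
    continuousAt_const.congr (Filter.mem_of_superset (hs.mem_nhds hx) fun y hy => (ht y hy).symm)
  refine continuous_iff_continuousAt.2 fun x => ?_
  by_cases hxQ : x ∈ Q
  · by_cases hxγ : x ∈ range γ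
    · obtain ⟨t, rfl⟩ := hxγ
      exact h.continuousAt_of_forall_mem_child hQ hγ hq t
    · obtain ⟨k, hk⟩ := h.exists_mem_child hxQ hxγ
      exact continuousAt_of_const (h.isClopen k).isOpen (hq k) hk
  · exact continuousAt_of_const hQ.compl.isOpen hout hxQ

theorem exists_retraction [CompactSpace I] (h : IsSplitting τ Q γ q) (hQ : IsClopen Q) :
    ∃ c : X → I, Continuous c ∧ (∀ t, c (γ t) = t) ∧ (∀ k, ∀ x ∈ q k, c x = τ k) ∧
      ∀ x ∉ Q, c x = τ 0 := by
  have exists_value (x : X) :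
      ∃ t, (∀ s, γ s = x → t = s) ∧ (∀ k, x ∈ q k → t = τ k) ∧ (x ∉ Q → t = τ 0) := by
    by_cases hxQ : x ∉ Q
    · refine ⟨τ 0, fun s hs => ?_, fun k hk => ?_, fun _ => rfl⟩
      exacts [absurd (h.range_subset ⟨s, hs⟩) hxQ, absurd (h.child_subset k hk) hxQ]
    rw [not_not] at hxQ
    by_cases hxγ : x ∈ range γ
    · obtain ⟨t, rfl⟩ := hxγ
      exact ⟨t, fun s hs => h.injective hs.symm, fun k hk => absurd hk (h.notMem_child t k),
        absurd hxQ⟩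
    · obtain ⟨k, hk⟩ := h.exists_mem_child hxQ hxγ
      exact ⟨τ k, fun s hs => absurd ⟨s, hs⟩ hxγ, fun l hl => by rw [h.eq_of_mem_child hk hl],
        absurd hxQ⟩
  choose c hγ hq hout using exists_value
  have hγ' (t : I) : c (γ t) = t := hγ _ t rfl
  have hq' (k : ℕ) (x : X) (hx : x ∈ q k) : c x = τ k := hq x k hx
  exact ⟨c, h.continuous_of_forall_mem_child hQ hγ' hq' hout, hγ', hq', hout⟩

end IsSplitting

namespace DecorationTree

variable {I X Y : Type*} [MetricSpace I] [MetricSpace X] [MetricSpace Y] {τ : ℕ → I}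

theorem isClopen (T : DecorationTree I X τ) : ∀ w, IsClopen (T.Q w)
  | [] => T.nil_eq ▸ isClopen_univ
  | k :: w => (T.splitting w).isClopen k

theorem nonempty (T : DecorationTree I X τ) (w : List ℕ) : (T.Q w).Nonempty :=
  ⟨T.γ w (τ 0), (T.splitting w).range_subset (mem_range_self _)⟩

theorem subset_of_suffix (T : DecorationTree I X τ) {v w : List ℕ} (h : v <:+ w) :
    T.Q w ⊆ T.Q v := by
  obtain ⟨u, rfl⟩ := h
  induction u with
  | nil => exact Subset.rfl
  | cons k u ih => exact ((T.splitting _).child_subset k).trans ih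

theorem eq_of_mem (T : DecorationTree I X τ) {x : X} :
    ∀ {v w : List ℕ}, x ∈ T.Q v → x ∈ T.Q w → v.length = w.length → v = w
  | [], [], _, _, _ => rfl
  | k :: v, l :: w, hv, hw, h => by
    obtain rfl : v = w := eq_of_mem T ((T.splitting v).child_subset k hv)
      ((T.splitting w).child_subset l hw) (Nat.succ.inj h)
    rw [(T.splitting v).eq_of_mem_child hv hw]

theorem γ_mem_iff_suffix (T : DecorationTree I X τ) (w : List ℕ) (t : I) (v : List ℕ) :
    T.γ w t ∈ T.Q v ↔ v <:+ w := by
  have hw : T.γ w t ∈ T.Q w := (T.splitting w).range_subset (mem_range_self t)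
  refine ⟨fun h => ?_, fun h => T.subset_of_suffix h hw⟩
  induction v with
  | nil => exact List.nil_suffix
  | cons k v ih =>
    obtain ⟨u, hu⟩ := ih ((T.splitting v).child_subset k h)
    rcases List.eq_nil_or_concat u with rfl | ⟨u, l, rfl⟩
    · obtain rfl : v = w := hu
      exact absurd h ((T.splitting v).notMem_child t k)
    · have hl : l :: v <:+ w := ⟨u, by rw [← hu]; simp⟩
      rwa [(T.splitting v).eq_of_mem_child h (T.subset_of_suffix hl hw)]

theorem exists_branch (T : DecorationTree I X τ) {x : X} (hx : ∀ w, x ∉ range (T.γ w)) :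
    ∃ w, IsBranch w ∧ ∀ n, x ∈ T.Q (w n) := by
  have exists_child (v : {v // x ∈ T.Q v}) : ∃ k, x ∈ T.Q (k :: v.1) :=
    (T.splitting v.1).exists_mem_child v.2 (hx v.1)
  choose child hchild using exists_child
  let node : ℕ → {v // x ∈ T.Q v} := fun n =>
    Nat.rec ⟨[], T.nil_eq ▸ mem_univ x⟩ (fun _ v => ⟨child v :: v.1, hchild v⟩) n
  exact ⟨fun n => (node n).1, ⟨rfl, fun n => ⟨child (node n), rfl⟩⟩, fun n => (node n).2⟩

theorem exists_mem_branch [CompactSpace X] (T : DecorationTree I X τ) {w : ℕ → List ℕ}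
    (hw : IsBranch w) : ∃ x, ∀ n, x ∈ T.Q (w n) := by
  have anti (n : ℕ) : T.Q (w (n + 1)) ⊆ T.Q (w n) := by
    obtain ⟨k, hk⟩ := hw.2 n
    exact hk ▸ (T.splitting (w n)).child_subset k
  obtain ⟨x, hx⟩ := IsCompact.nonempty_iInter_of_sequence_nonempty_isCompact_isClosed
    (fun n => T.Q (w n)) anti (fun n => T.nonempty _) (T.isClopen _).isClosed.isCompact
    fun n => (T.isClopen _).isClosed
  exact ⟨x, mem_iInter.1 hx⟩

section Itinerary

variable [CompactSpace I]

/-- The coordinate of a point at the node `w`: the position at which the point sits on, or is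
attached to, the copy `γ w`. -/
noncomputable def coord (T : DecorationTree I X τ) (w : List ℕ) : X → I :=
  ((T.splitting w).exists_retraction (T.isClopen w)).choose

theorem continuous_coord (T : DecorationTree I X τ) (w : List ℕ) : Continuous (T.coord w) :=
  ((T.splitting w).exists_retraction (T.isClopen w)).choose_spec.1

theorem coord_γ (T : DecorationTree I X τ) (w : List ℕ) (t : I) : T.coord w (T.γ w t) = t :=
  ((T.splitting w).exists_retraction (T.isClopen w)).choose_spec.2.1 t

theorem coord_of_mem_child (T : DecorationTree I X τ) {w : List ℕ} {k : ℕ} {x : X}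
    (h : x ∈ T.Q (k :: w)) : T.coord w x = τ k :=
  ((T.splitting w).exists_retraction (T.isClopen w)).choose_spec.2.2.1 k x h

theorem coord_of_notMem (T : DecorationTree I X τ) {w : List ℕ} {x : X} (h : x ∉ T.Q w) :
    T.coord w x = τ 0 :=
  ((T.splitting w).exists_retraction (T.isClopen w)).choose_spec.2.2.2 x h

/-- The itinerary of a point: the nodes that contain it, and its coordinates at all nodes. -/
noncomputable def itinerary (T : DecorationTree I X τ) (x : X) (w : List ℕ) : Bool × I :=
  ((T.Q w).boolIndicator x, T.coord w x)

theorem continuous_itinerary (T : DecorationTree I X τ) : Continuous T.itinerary :=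
  continuous_pi fun w => .prodMk ((continuous_boolIndicator_iff_isClopen _).2 (T.isClopen w))
    (T.continuous_coord w)

theorem mem_iff_of_itinerary_eq {T : DecorationTree I X τ} {T' : DecorationTree I Y τ} {x : X}
    {y : Y} (h : T.itinerary x = T'.itinerary y) (w : List ℕ) : x ∈ T.Q w ↔ y ∈ T'.Q w := by
  rw [mem_iff_boolIndicator, mem_iff_boolIndicator]
  exact (congrArg Prod.fst (congrFun h w)).congr_left

theorem itinerary_eq_of_mem_iff {T : DecorationTree I X τ} {T' : DecorationTree I Y τ} {x : X}
    {y : Y} (h : ∀ w, x ∈ T.Q w ↔ y ∈ T'.Q w)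
    (hc : ∀ w, x ∈ range (T.γ w) → T.coord w x = T'.coord w y) :
    T.itinerary x = T'.itinerary y := by
  funext w
  have hb : (T.Q w).boolIndicator x = (T'.Q w).boolIndicator y := by
    rw [Bool.eq_iff_iff, ← mem_iff_boolIndicator, ← mem_iff_boolIndicator, h w]
  refine Prod.ext hb ?_
  change T.coord w x = T'.coord w y
  by_cases hxγ : x ∈ range (T.γ w)
  · exact hc w hxγ
  by_cases hxQ : x ∈ T.Q w
  · obtain ⟨k, hk⟩ := (T.splitting w).exists_mem_child hxQ hxγ
    rw [T.coord_of_mem_child hk, T'.coord_of_mem_child ((h _).1 hk)]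
  · rw [T.coord_of_notMem hxQ, T'.coord_of_notMem (mt (h w).2 hxQ)]

theorem injective_itinerary [CompactSpace X] (T : DecorationTree I X τ) :
    Function.Injective T.itinerary := by
  intro x y h
  have hmem := mem_iff_of_itinerary_eq h
  by_cases hx : ∃ w, x ∈ range (T.γ w)
  · obtain ⟨w, s, rfl⟩ := hx
    have hy : y ∈ range (T.γ w) := by
      by_contra hy
      have hyQ := (hmem w).1 ((T.splitting w).range_subset (mem_range_self s))
      obtain ⟨k, hk⟩ := (T.splitting w).exists_mem_child hyQ hy
      exact (T.splitting w).notMem_child s k ((hmem _).2 hk)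
    obtain ⟨t, rfl⟩ := hy
    have hst : T.coord w (T.γ w s) = T.coord w (T.γ w t) := congrArg Prod.snd (congrFun h w)
    rw [T.coord_γ, T.coord_γ] at hst
    rw [hst]
  · obtain ⟨w, hw, hxw⟩ := T.exists_branch (not_exists.1 hx)
    refine eq_of_forall_dist_le fun ε hε => ?_
    obtain ⟨n, hn⟩ := T.diam_lt w hw ε hε
    exact (dist_le_diam_of_mem isBounded_of_compactSpace (hxw n) ((hmem _).1 (hxw n))).trans hn.le

theorem itinerary_γ (T : DecorationTree I X τ) (T' : DecorationTree I Y τ) (w : List ℕ) (t : I) :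
    T.itinerary (T.γ w t) = T'.itinerary (T'.γ w t) := by
  refine itinerary_eq_of_mem_iff (fun v => ?_) fun v hv => ?_
  · rw [T.γ_mem_iff_suffix, T'.γ_mem_iff_suffix]
  · have hvw : v <:+ w := (T.γ_mem_iff_suffix w t v).1 ((T.splitting v).range_subset hv)
    obtain ⟨s, hs⟩ := hv
    have hwv : w <:+ v := (T.γ_mem_iff_suffix v s w).1
      (hs ▸ (T.splitting w).range_subset (mem_range_self t))
    obtain rfl : v = w := hvw.eq_of_length_le hwv.length_le
    rw [T.coord_γ, T'.coord_γ]

theorem range_itinerary_subset [CompactSpace Y] (T : DecorationTree I X τ)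
    (T' : DecorationTree I Y τ) : range T.itinerary ⊆ range T'.itinerary := by
  rintro _ ⟨x, rfl⟩
  by_cases hx : ∃ w, x ∈ range (T.γ w)
  · obtain ⟨w, t, rfl⟩ := hx
    exact ⟨T'.γ w t, (T.itinerary_γ T' w t).symm⟩
  · obtain ⟨w, hw, hxw⟩ := T.exists_branch (not_exists.1 hx)
    obtain ⟨y, hyw⟩ := T'.exists_mem_branch hw
    have hxy (v : List ℕ) : x ∈ T.Q v ↔ y ∈ T'.Q v := by
      have hlen : v.length = (w v.length).length := (hw.length_eq _).symm
      constructor <;> intro hv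
      · rw [T.eq_of_mem hv (hxw _) hlen]
        exact hyw _
      · rw [T'.eq_of_mem hv (hyw _) hlen]
        exact hxw _
    exact ⟨y, (itinerary_eq_of_mem_iff hxy fun v hv => absurd ⟨v, hv⟩ hx).symm⟩

theorem nonempty_homeomorph [CompactSpace X] [CompactSpace Y] (T : DecorationTree I X τ)
    (T' : DecorationTree I Y τ) : Nonempty (X ≃ₜ Y) := by
  have e := (T.continuous_itinerary.isClosedEmbedding T.injective_itinerary).isEmbedding
  have e' := (T'.continuous_itinerary.isClosedEmbedding T'.injective_itinerary).isEmbedding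
  have hrange : range T.itinerary = range T'.itinerary :=
    (T.range_itinerary_subset T').antisymm (T'.range_itinerary_subset T)
  exact ⟨(e.toHomeomorph.trans (.setCongr hrange)).trans e'.toHomeomorph.symm⟩

end Itinerary

end DecorationTree

/-- The components of `X` form a null family: only finitely many have diameter at least `ε`. -/
def HasNullComponents (X : Type*) [PseudoMetricSpace X] : Prop :=
  ∀ ε > 0, {S ∈ range (connectedComponent : X → Set X) | ε ≤ diam S}.Finite

/-- A connected component which is an injective continuous image of `I`: for compact `I`, an
embedded copy of `I`. -/
def IsCopyComponent (I : Type*) {X : Type*} [TopologicalSpace I] [TopologicalSpace X]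
    (S : Set X) : Prop :=
  S ∈ range (connectedComponent : X → Set X) ∧
    ∃ γ : I → X, Continuous γ ∧ Function.Injective γ ∧ range γ = S

/-- A space decorated by copies of `I`: its components are points and copies of `I`, they form a
null family, and every nonempty open set contains at least two copies of `I`. -/
structure IsDecorated (I X : Type*) [MetricSpace I] [MetricSpace X] : Prop where
  component : ∀ x : X, (connectedComponent x).Subsingleton ∨
    IsCopyComponent I (connectedComponent x)
  null : HasNullComponents X
  dense : ∀ U : Set X, IsOpen U → U.Nonempty → ∃ S T : Set X, S ≠ T ∧
    IsCopyComponent I S ∧ IsCopyComponent I T ∧ S ⊆ U ∧ T ⊆ U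

/-- A family that comes back infinitely often to every neighbourhood of every point. -/
def IsAccumulating {I ι : Type*} [PseudoMetricSpace I] (f : ι → I) : Prop :=
  ∀ s, ∀ ε > 0, {i | dist (f i) s < ε}.Infinite

section Accumulating

variable {I : Type*} [PseudoMetricSpace I]

theorem exists_isAccumulating (I : Type*) [PseudoMetricSpace I] [SeparableSpace I]
    [Nonempty I] : ∃ τ : ℕ → I, IsAccumulating τ := by
  refine ⟨fun n => denseSeq I n.unpair.1, fun s ε hε => ?_⟩
  obtain ⟨k, hk⟩ := (denseRange_denseSeq I).exists_dist_lt s hε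
  refine infinite_of_injective_forall_mem (f := Nat.pair k)
    (fun a b h => (Nat.pair_eq_pair.1 h).2) fun m => ?_
  change dist (denseSeq I (Nat.pair k m).unpair.1) s < ε
  rwa [Nat.unpair_pair, dist_comm]

theorem IsAccumulating.exists_injective_dist_lt {v : ℕ → I} (hv : IsAccumulating v) (u : ℕ → I) :
    ∃ φ : ℕ → ℕ, Function.Injective φ ∧ ∀ n, dist (v (φ n)) (u n) < 1 / (n + 1 : ℝ) := by
  obtain ⟨φ, hφ, h⟩ := Filter.extraction_forall_of_frequently
    (P := fun n m => dist (v m) (u n) < 1 / (n + 1 : ℝ)) fun n =>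
      Nat.frequently_atTop_iff_infinite.2 (hv (u n) _ Nat.one_div_pos_of_nat)
  exact ⟨φ, hφ.injective, h⟩

theorem IsAccumulating.exists_bijective_dist_lt {f g : ℕ → I} (hf : IsAccumulating f)
    (hg : IsAccumulating g) : ∃ h : ℕ → ℕ, Function.Bijective h ∧
      ∀ ε > 0, ∀ᶠ n in Filter.atTop, dist (f n) (g (h n)) < ε := by
  obtain ⟨φ, hφ, hφg⟩ := hg.exists_injective_dist_lt f
  obtain ⟨ψ, hψ, hψf⟩ := hf.exists_injective_dist_lt g
  obtain ⟨h, hb, hR⟩ := Function.Embedding.schroeder_bernstein_of_rel hφ hψ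
    (fun a b => dist (f a) (g b) < 1 / (a + 1 : ℝ) ∨ dist (f a) (g b) < 1 / (b + 1 : ℝ))
    (fun a => Or.inl (by rw [dist_comm]; exact hφg a)) (fun b => Or.inr (hψf b))
  refine ⟨h, hb, fun ε hε => ?_⟩
  have hsmall := (tendsto_order.1 tendsto_one_div_add_atTop_nhds_zero_nat).2 ε hε
  filter_upwards [hsmall, hb.1.nat_tendsto_atTop.eventually hsmall] with n hn hhn
  exact (hR n).elim hn.trans' hhn.trans'

end Accumulating

section ClopenPartition

variable {X : Type*}

theorem exists_isClopen_connectedComponent_subset [TopologicalSpace X] [T2Space X] [CompactSpace X]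
    {x : X} {U : Set X} (hU : IsOpen U) (h : connectedComponent x ⊆ U) :
    ∃ P, IsClopen P ∧ x ∈ P ∧ P ⊆ U := by
  rw [connectedComponent_eq_iInter_isClopen] at h
  have : Nonempty {s : Set X // IsClopen s ∧ x ∈ s} := ⟨⟨univ, isClopen_univ, mem_univ x⟩⟩
  obtain ⟨s, hs⟩ := exists_subset_nhds_of_isCompact'
    (V := fun s : {s : Set X // IsClopen s ∧ x ∈ s} => s.1)
    (fun s t => ⟨⟨s.1 ∩ t.1, s.2.1.inter t.2.1, s.2.2, t.2.2⟩, inter_subset_left,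
      inter_subset_right⟩) (fun s => s.2.1.isClosed.isCompact) (fun s => s.2.1.isClosed)
    (U := U) fun y hy => hU.mem_nhds (h hy)
  exact ⟨s.1, s.2.1, s.2.2, hs⟩

theorem exists_finite_clopen_disjoint_refinement [TopologicalSpace X] (s : Finset X)
    (P : X → Set X) (hP : ∀ x ∈ s, IsClopen (P x)) :
    ∃ 𝒬 : Set (Set X), 𝒬.Finite ∧ (∀ q ∈ 𝒬, IsClopen q ∧ q.Nonempty ∧ ∃ x ∈ s, q ⊆ P x) ∧
      𝒬.PairwiseDisjoint id ∧ ⋃₀ 𝒬 = ⋃ x ∈ s, P x := by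
  classical
  induction s using Finset.induction_on with
  | empty => exact ⟨∅, finite_empty, by simp, by simp, by simp⟩
  | insert a s _ ih =>
    obtain ⟨𝒬, hfin, hq, hdisj, hun⟩ := ih fun x hx => hP x (Finset.mem_insert_of_mem hx)
    have hrest : IsClopen (⋃ x ∈ s, P x) :=
      s.finite_toSet.isClopen_biUnion fun x hx => hP x (Finset.mem_insert_of_mem hx)
    set A := P a \ ⋃ x ∈ s, P x with hA
    have hq' (q) (hqQ : q ∈ 𝒬) : IsClopen q ∧ q.Nonempty ∧ ∃ x ∈ insert a s, q ⊆ P x := by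
      obtain ⟨hqc, hqne, x, hx, hqx⟩ := hq q hqQ
      exact ⟨hqc, hqne, x, Finset.mem_insert_of_mem hx, hqx⟩
    have hun' : ⋃ x ∈ insert a s, P x = A ∪ ⋃ x ∈ s, P x := by
      rw [Finset.set_biUnion_insert, hA, sdiff_union_self]
    rcases A.eq_empty_or_nonempty with hAe | hAne
    · exact ⟨𝒬, hfin, hq', hdisj, by rw [hun', hAe, hun, empty_union]⟩
    · refine ⟨insert A 𝒬, hfin.insert _, ?_, hdisj.insert fun q hqQ _ => ?_,
        by rw [hun', sUnion_insert, hun]⟩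
      · rintro q (rfl | hqQ)
        · exact ⟨(hP a (Finset.mem_insert_self _ _)).diff hrest, hAne, a,
            Finset.mem_insert_self _ _, sdiff_subset⟩
        · exact hq' q hqQ
      · exact disjoint_left.2 fun y hyA hyq => hyA.2 (hun ▸ mem_sUnion_of_mem hyq hqQ)

theorem exists_finite_clopen_partition [MetricSpace X] [CompactSpace X] {L : Set X}
    (hL : IsClopen L) {η : ℝ} (hη : 0 < η) :
    ∃ 𝒬 : Set (Set X), 𝒬.Finite ∧
      (∀ q ∈ 𝒬, IsClopen q ∧ q.Nonempty ∧ ∃ x ∈ L, diam q ≤ diam (connectedComponent x) + η) ∧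
      𝒬.PairwiseDisjoint id ∧ ⋃₀ 𝒬 = L := by
  have exists_nhd (x) (hx : x ∈ L) : ∃ P, IsClopen P ∧ x ∈ P ∧ P ⊆ L ∧
      diam P ≤ diam (connectedComponent x) + η := by
    obtain ⟨P, hP, hxP, hPU⟩ := exists_isClopen_connectedComponent_subset
      (isOpen_thickening (δ := η / 2) (E := connectedComponent x))
      (self_subset_thickening (by positivity) _)
    refine ⟨P ∩ L, hP.inter hL, ⟨hxP, hx⟩, inter_subset_right, ?_⟩
    calc diam (P ∩ L) ≤ diam (thickening (η / 2) (connectedComponent x)) :=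
          diam_mono (inter_subset_left.trans hPU) isBounded_of_compactSpace
      _ ≤ diam (connectedComponent x) + 2 * (η / 2) := diam_thickening_le _ (by positivity)
      _ = diam (connectedComponent x) + η := by ring
  choose! P hP hxP hPL hdiam using exists_nhd
  obtain ⟨s, hsL, hs⟩ := hL.isClosed.isCompact.elim_nhds_subcover P
    fun x hx => (hP x hx).isOpen.mem_nhds (hxP x hx)
  obtain ⟨𝒬, hfin, hq, hdisj, hun⟩ := exists_finite_clopen_disjoint_refinement s P
    fun x hx => hP x (hsL x hx)
  refine ⟨𝒬, hfin, fun q hqQ => ?_, hdisj, hun.trans (Subset.antisymm ?_ hs)⟩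
  · obtain ⟨hqc, hqne, x, hx, hqx⟩ := hq q hqQ
    exact ⟨hqc, hqne, x, hsL x hx,
      (diam_mono hqx isBounded_of_compactSpace).trans (hdiam x (hsL x hx))⟩
  · exact iUnion₂_subset fun x hx => hPL x (hsL x hx)

end ClopenPartition

section Decomposition

theorem HasNullComponents.eventually_diam_lt {X : Type*} [PseudoMetricSpace X]
    (hX : HasNullComponents X) {L : ℕ → Set X} (hL : ∀ n, IsClopen (L n))
    (hdisj : Pairwise (Function.onFun Disjoint L)) {ε : ℝ}
    (hε : 0 < ε) : ∀ᶠ n in Filter.atTop, ∀ x ∈ L n, diam (connectedComponent x) < ε := by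
  cases isEmpty_or_nonempty X
  · exact .of_forall fun n x => isEmptyElim x
  rw [← Nat.cofinite_eq_atTop, Filter.eventually_cofinite]
  have exists_large (n) (hn : n ∈ {n | ¬∀ x ∈ L n, diam (connectedComponent x) < ε}) :
      ∃ x ∈ L n, ε ≤ diam (connectedComponent x) := by
    simpa only [mem_ofPred_eq, not_forall, not_lt, exists_prop] using hn
  choose! x hxL hx using exists_large
  have hinj : InjOn (fun n => connectedComponent (x n))
      {n | ¬∀ x ∈ L n, diam (connectedComponent x) < ε} := by
    intro m hm n hn (hmn : connectedComponent (x m) = connectedComponent (x n))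
    by_contra hne
    have hxn : x n ∈ L m := (hL m).connectedComponent_subset (hxL m hm)
      (hmn ▸ mem_connectedComponent)
    exact disjoint_left.1 (hdisj hne) hxn (hxL n hn)
  exact .of_injOn (t := {S ∈ range connectedComponent | ε ≤ diam S})
    (fun n hn => ⟨mem_range_self _, hx n hn⟩) hinj (hX ε hε)

variable {X : Type*} [MetricSpace X] [CompactSpace X]

theorem exists_isClopen_shells {Q : Set X} (hQ : IsClopen Q) (x : X) :
    ∃ L : ℕ → Set X, (∀ n, IsClopen (L n)) ∧ Pairwise (Function.onFun Disjoint L) ∧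
      ⋃ n, L n = Q \ connectedComponent x ∧
      ∀ ε > 0, ∀ᶠ n in Filter.atTop, L n ⊆ thickening ε (connectedComponent x) := by
  have exists_nhd (n : ℕ) : ∃ G, IsClopen G ∧ x ∈ G ∧
      G ⊆ thickening (1 / (n + 1 : ℝ)) (connectedComponent x) :=
    exists_isClopen_connectedComponent_subset isOpen_thickening
      (self_subset_thickening Nat.one_div_pos_of_nat _)
  choose G hG hxG hGt using exists_nhd
  have hinter : ⋂ n, G n = connectedComponent x := by
    refine Subset.antisymm (fun y hy => ?_)
      (subset_iInter fun n => (hG n).connectedComponent_subset (hxG n))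
    rw [← isClosed_connectedComponent.closure_eq, closure_eq_iInter_thickening, mem_iInter₂]
    intro ε hε
    obtain ⟨n, hn⟩ := exists_nat_one_div_lt hε
    exact thickening_mono hn.le _ (hGt n (mem_iInter.1 hy n))
  refine ⟨disjointed fun n => Q \ G n, fun n => ?_, disjoint_disjointed _, ?_, fun ε hε => ?_⟩
  · exact disjointedRec (fun _ _ hs => hs.diff (hQ.diff (hG _))) (hQ.diff (hG n))
  · rw [iUnion_disjointed, ← sdiff_iInter, hinter]
  · obtain ⟨n, hn⟩ := exists_nat_one_div_lt hε
    filter_upwards [Filter.eventually_gt_atTop n] with m hm y hy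
    rw [disjointed_eq_inter_compl] at hy
    have hyG : y ∈ G n := by_contra fun hyG => mem_iInter₂.1 hy.2 n hm ⟨hy.1.1, hyG⟩
    exact thickening_mono hn.le _ (hGt n hyG)

theorem HasNullComponents.exists_clopen_decomposition (hX : HasNullComponents X) {Q : Set X}
    (hQ : IsClopen Q) (x₀ : X) {δ : ℝ} (hδ : 0 < δ) :
    ∃ 𝒬 : Set (Set X), 𝒬.Countable ∧
      (∀ q ∈ 𝒬, IsClopen q ∧ q.Nonempty ∧ ∃ x ∈ Q, diam q ≤ diam (connectedComponent x) + δ) ∧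
      𝒬.PairwiseDisjoint id ∧ ⋃₀ 𝒬 = Q \ connectedComponent x₀ ∧
      ∀ ε > 0, {q ∈ 𝒬 | ¬∃ s ∈ connectedComponent x₀, q ⊆ ball s ε}.Finite := by
  obtain ⟨L, hL, hLdisj, hLun, hLnear⟩ := exists_isClopen_shells hQ x₀
  have hLQ (n : ℕ) : L n ⊆ Q := ((subset_iUnion L n).trans hLun.subset).trans sdiff_subset
  have exists_partition (n : ℕ) := exists_finite_clopen_partition (hL n)
    (η := min δ (1 / (n + 1 : ℝ))) (lt_min hδ Nat.one_div_pos_of_nat)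
  choose 𝒬 hfin hq hdisj hun using exists_partition
  have hqL {n q} (h : q ∈ 𝒬 n) : q ⊆ L n := hun n ▸ subset_sUnion_of_mem h
  refine ⟨⋃ n, 𝒬 n, countable_iUnion fun n => (hfin n).countable, ?_, ?_, ?_, fun ε hε => ?_⟩
  · intro q hqQ
    obtain ⟨n, hn⟩ := mem_iUnion.1 hqQ
    obtain ⟨hqc, hqne, x, hx, hqx⟩ := hq n q hn
    exact ⟨hqc, hqne, x, hLQ n hx, hqx.trans (by gcongr; exact min_le_left _ _)⟩
  · intro q hqQ q' hqQ' hne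
    obtain ⟨n, hn⟩ := mem_iUnion.1 hqQ
    obtain ⟨m, hm⟩ := mem_iUnion.1 hqQ'
    rcases eq_or_ne n m with rfl | hnm
    · exact hdisj n hn hm hne
    · exact (hLdisj hnm).mono (hqL hn) (hqL hm)
  · rw [sUnion_iUnion, iUnion_congr hun, hLun]
  have near : ∀ᶠ n in Filter.atTop, ∀ q ∈ 𝒬 n, ∃ s ∈ connectedComponent x₀, q ⊆ ball s ε := by
    filter_upwards [hLnear (ε / 3) (by positivity),
      hX.eventually_diam_lt hL hLdisj (show 0 < ε / 3 by positivity),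
      (tendsto_order.1 tendsto_one_div_add_atTop_nhds_zero_nat).2 (ε / 3)
        (show (0 : ℝ) < ε / 3 by positivity)] with n hn hdiam hsmall q hqn
    obtain ⟨-, ⟨y, hy⟩, x, hx, hqx⟩ := hq n q hqn
    obtain ⟨s, hs, hys⟩ := mem_thickening_iff.1 (hn (hqL hqn hy))
    refine ⟨s, hs, fun z hz => ?_⟩
    have hzy : dist z y ≤ diam q := dist_le_diam_of_mem isBounded_of_compactSpace hz hy
    rw [mem_ball]
    linarith [dist_triangle z y s, hdiam x hx, min_le_right δ (1 / (n + 1 : ℝ))]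
  obtain ⟨N, hN⟩ := Filter.eventually_atTop.1 near
  refine ((Finset.range N).finite_toSet.biUnion fun n _ => hfin n).subset ?_
  rintro q ⟨hqQ, hfar⟩
  obtain ⟨n, hn⟩ := mem_iUnion.1 hqQ
  have hnN : n < N := not_le.1 fun hNn => hfar (hN n hNn q hn)
  exact mem_biUnion (Finset.mem_coe.2 (Finset.mem_range.2 hnN)) hn

end Decomposition

section Attaching

variable {I X : Type*} [MetricSpace I] [MetricSpace X]

theorem exists_attaching_points [CompactSpace I] [Nonempty I] {ι : Type*} {γ : I → X}
    (hγ : Continuous γ) {q : ι → Set X} (hq : ∀ i, (q i).Nonempty)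
    (hnear : ∀ ε > 0, ∀ᶠ i in Filter.cofinite, ∃ s, q i ⊆ ball (γ s) ε) :
    ∃ t : ι → I, ∀ ε > 0, ∀ᶠ i in Filter.cofinite, q i ⊆ ball (γ (t i)) ε := by
  have exists_nearest (i : ι) : ∃ t : I, ∃ z ∈ q i, ∀ s, dist z (γ t) ≤ dist z (γ s) := by
    obtain ⟨z, hz⟩ := hq i
    obtain ⟨t, -, ht⟩ := isCompact_univ.exists_isMinOn (univ_nonempty (α := I))
      (f := fun t => dist z (γ t)) (by fun_prop)
    exact ⟨t, z, hz, fun s => ht (mem_univ s)⟩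
  choose t z hz hmin using exists_nearest
  refine ⟨t, fun ε hε => ?_⟩
  filter_upwards [hnear (ε / 3) (by positivity)] with i ⟨s, hs⟩ y hy
  have hys : dist y (γ s) < ε / 3 := hs hy
  have hzs : dist (z i) (γ s) < ε / 3 := hs (hz i)
  rw [mem_ball]
  linarith [dist_triangle y (γ s) (γ (t i)), dist_triangle_left (γ s) (γ (t i)) (z i), hmin i s]

theorem IsDecorated.infinite_inter_ball_nonempty (h : IsDecorated I X) {ι : Type*} {Q : Set X}
    (hQ : IsClopen Q) {x₀ : X} {q : ι → Set X} (hq : ∀ i, IsClosed (q i))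
    (hun : ⋃ i, q i = Q \ connectedComponent x₀) {s : X} (hsQ : s ∈ Q)
    (hs : s ∈ connectedComponent x₀) {ε : ℝ} (hε : 0 < ε) :
    {i | (q i ∩ ball s ε).Nonempty}.Infinite := by
  intro hfin
  set U := (Q ∩ ball s ε) \ ⋃ i ∈ {i | (q i ∩ ball s ε).Nonempty}, q i
  have hU : IsOpen U := (hQ.isOpen.inter isOpen_ball).sdiff (hfin.isClosed_biUnion fun i _ => hq i)
  have hsU : s ∈ U := by
    refine ⟨⟨hsQ, mem_ball_self hε⟩, fun hmem => ?_⟩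
    obtain ⟨i, -, hsi⟩ := mem_iUnion₂.1 hmem
    exact (hun.subset (mem_iUnion_of_mem i hsi)).2 hs
  have eq_component {C : Set X} (hC : IsCopyComponent I C) (hCU : C ⊆ U) :
      C = connectedComponent x₀ := by
    obtain ⟨⟨x, rfl⟩, -⟩ := hC
    have hxU : x ∈ U := hCU mem_connectedComponent
    refine (connectedComponent_eq (not_not.1 fun hx => ?_)).symm
    obtain ⟨i, hxi⟩ := mem_iUnion.1 (hun.superset ⟨hxU.1.1, hx⟩)
    exact hxU.2 (mem_biUnion (x := i) ⟨x, hxi, hxU.1.2⟩ hxi)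
  obtain ⟨S, T, hST, hS, hT, hSU, hTU⟩ := h.dense U hU ⟨s, hsU⟩
  exact hST ((eq_component hS hSU).trans (eq_component hT hTU).symm)

theorem isAccumulating_of_infinite_inter_ball [CompactSpace I] {ι : Type*} {γ : I → X}
    (hγ : Continuous γ) (hinj : Function.Injective γ) {q : ι → Set X} {t : ι → I}
    (hnear : ∀ ε > 0, ∀ᶠ i in Filter.cofinite, q i ⊆ ball (γ (t i)) ε)
    (hinf : ∀ s, ∀ ε > 0, {i | (q i ∩ ball (γ s) ε).Nonempty}.Infinite) : IsAccumulating t := by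
  intro s ε hε
  have hnhds : ball s ε ∈ (𝓝 (γ s)).comap γ := by
    rw [← (hγ.isClosedEmbedding hinj).isInducing.nhds_eq_comap]
    exact ball_mem_nhds s hε
  obtain ⟨η, hη, hball⟩ := (nhds_basis_ball.comap γ).mem_iff.1 hnhds
  refine ((hinf s (η / 2) (half_pos hη)).sdiff (hnear (η / 2) (half_pos hη))).mono ?_
  rintro i ⟨⟨y, hyq, hys⟩, hi⟩
  have hyt : dist y (γ (t i)) < η / 2 := not_not.1 hi hyq
  rw [mem_ball] at hys
  have hts : dist (γ (t i)) (γ s) < η := by linarith [dist_triangle_left (γ (t i)) (γ s) y]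
  exact hball hts

end Attaching

namespace IsDecorated

variable {I X : Type*} [MetricSpace I] [MetricSpace X]

theorem exists_maximal_copy (h : IsDecorated I X) {Q : Set X} (hQ : IsClopen Q)
    (hne : Q.Nonempty) : ∃ x ∈ Q, IsCopyComponent I (connectedComponent x) ∧
      ∀ y ∈ Q, diam (connectedComponent y) ≤ diam (connectedComponent x) := by
  by_cases hpos : ∃ y ∈ Q, 0 < diam (connectedComponent y)
  · obtain ⟨y, hy, hy0⟩ := hpos
    have hfin : {S ∈ connectedComponent '' Q | diam (connectedComponent y) ≤ diam S}.Finite :=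
      (h.null _ hy0).subset fun S hS => ⟨image_subset_range _ _ hS.1, hS.2⟩
    obtain ⟨_, ⟨⟨x, hx, rfl⟩, hyx⟩, hmax⟩ := hfin.exists_maximalFor diam _
      ⟨connectedComponent y, mem_image_of_mem _ hy, le_rfl⟩
    refine ⟨x, hx, (h.component x).resolve_left fun hs => ?_, fun z hz => ?_⟩
    · rw [diam_subsingleton hs] at hyx
      exact hy0.not_ge hyx
    · by_contra! hlt
      exact hlt.not_ge (hmax ⟨mem_image_of_mem _ hz, hyx.trans hlt.le⟩ hlt.le)
  · push Not at hpos
    obtain ⟨S, -, -, hS, -, hSQ, -⟩ := h.dense Q hQ.isOpen hne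
    obtain ⟨x, rfl⟩ := hS.1
    exact ⟨x, hSQ mem_connectedComponent, hS, fun y hy => (hpos y hy).trans diam_nonneg⟩

variable [CompactSpace I] [CompactSpace X] [Nonempty I]

theorem exists_attached_family (h : IsDecorated I X) {Q : Set X} (hQ : IsClopen Q)
    (hne : Q.Nonempty) {δ : ℝ} (hδ : 0 < δ) :
    ∃ (γ : I → X) (q : ℕ → Set X) (t : ℕ → I), Continuous γ ∧ Function.Injective γ ∧
      range γ ∈ range (connectedComponent : X → Set X) ∧ range γ ⊆ Q ∧
      (∀ k, IsClopen (q k) ∧ (q k).Nonempty ∧ diam (q k) ≤ diam (range γ) + δ) ∧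
      Pairwise (Function.onFun Disjoint q) ∧ ⋃ k, q k = Q \ range γ ∧ IsAccumulating t ∧
      ∀ ε > 0, ∀ᶠ k in Filter.cofinite, q k ⊆ ball (γ (t k)) ε := by
  obtain ⟨x₀, hx₀, ⟨-, γ, hγ, hinj, hrange⟩, hmax⟩ := h.exists_maximal_copy hQ hne
  obtain ⟨𝒬, hcount, hq, hdisj, hun, hnear⟩ := h.null.exists_clopen_decomposition hQ x₀ hδ
  have hrQ : range γ ⊆ Q := hrange ▸ hQ.connectedComponent_subset hx₀
  have hun' : ⋃ q : 𝒬, q.1 = Q \ connectedComponent x₀ := by rw [← sUnion_eq_iUnion, hun]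
  have hnear' (ε : ℝ) (hε : 0 < ε) :
      ∀ᶠ q : 𝒬 in Filter.cofinite, ∃ s, (q : Set X) ⊆ ball (γ s) ε := by
    refine ((hnear ε hε).preimage Subtype.val_injective.injOn).subset fun q hqfar => ?_
    rw [← hrange]
    exact ⟨q.2, by simpa using hqfar⟩
  obtain ⟨t, ht⟩ := exists_attaching_points hγ (fun q : 𝒬 => (hq q.1 q.2).2.1) hnear'
  have hacc : IsAccumulating t := isAccumulating_of_infinite_inter_ball hγ hinj ht fun s ε hε =>
    h.infinite_inter_ball_nonempty hQ (fun q : 𝒬 => (hq q.1 q.2).1.isClosed) hun'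
      (hrQ (mem_range_self s)) (hrange ▸ mem_range_self s) hε
  have : Countable 𝒬 := hcount
  have : Infinite 𝒬 := infinite_univ_iff.1
    ((hacc (Classical.arbitrary I) 1 one_pos).mono (subset_univ _))
  obtain ⟨e⟩ : Nonempty (ℕ ≃ 𝒬) := nonempty_equiv_of_countable
  refine ⟨γ, fun k => (e k).1, t ∘ e, hγ, hinj, ⟨x₀, hrange.symm⟩, hrQ, fun k => ?_,
    fun k l hkl => ?_, ?_, fun s ε hε => ?_, fun ε hε => ?_⟩
  · obtain ⟨hqc, hqne, x, hx, hqx⟩ := hq _ (e k).2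
    exact ⟨hqc, hqne, hqx.trans (by rw [hrange]; gcongr; exact hmax x hx)⟩
  · exact hdisj (e k).2 (e l).2 (Subtype.coe_injective.ne (e.injective.ne hkl))
  · rw [e.surjective.iUnion_comp (fun q : 𝒬 => q.1), hun', hrange]
  · exact (hacc s ε hε).preimage (by rw [e.range_eq_univ]; exact subset_univ _)
  · exact e.injective.tendsto_cofinite.eventually (ht ε hε)

theorem exists_isSplitting (h : IsDecorated I X) {τ : ℕ → I} (hτ : IsAccumulating τ) {Q : Set X}
    (hQ : IsClopen Q) (hne : Q.Nonempty) {δ : ℝ} (hδ : 0 < δ) :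
    ∃ γ q, IsSplitting τ Q γ q ∧ range γ ∈ range (connectedComponent : X → Set X) ∧
      ∀ k, diam (q k) ≤ diam (range γ) + δ := by
  obtain ⟨γ, q, t, hγ, hinj, hcomp, hrQ, hq, hdisj, hun, ht, hnear⟩ :=
    h.exists_attached_family hQ hne hδ
  obtain ⟨b, hb, hbt⟩ := hτ.exists_bijective_dist_lt ht
  refine ⟨γ, fun k => q (b k), ⟨hγ, hinj, fun k => (hq _).1, fun k => (hq _).2.1, ?_, fun k => ?_,
    fun k l hkl => hdisj (hb.injective.ne hkl), fun ε hε => ?_⟩, hcomp, fun k => (hq _).2.2⟩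
  · rw [hb.surjective.iUnion_comp q, hun, union_sdiff_self, union_eq_self_of_subset_left hrQ]
  · exact disjoint_left.2 fun x hxγ hxq => (hun.subset (mem_iUnion_of_mem _ hxq)).2 hxγ
  · obtain ⟨η, hη, hγη⟩ := Metric.uniformContinuous_iff.1
      (CompactSpace.uniformContinuous_of_continuous hγ) (ε / 2) (half_pos hε)
    have hqt : ∀ᶠ k in Filter.atTop, q (b k) ⊆ ball (γ (t (b k))) (ε / 2) := by
      rw [← Nat.cofinite_eq_atTop]
      exact hb.injective.tendsto_cofinite.eventually (hnear _ (half_pos hε))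
    filter_upwards [hqt, hbt η hη] with k hk hτk y hy
    have hyt : dist y (γ (t (b k))) < ε / 2 := hk hy
    rw [mem_ball]
    linarith [dist_triangle_right y (γ (τ k)) (γ (t (b k))), hγη hτk]

theorem exists_iterated_isSplitting (h : IsDecorated I X) [Nonempty X] {τ : ℕ → I}
    (hτ : IsAccumulating τ) : ∃ (Q : List ℕ → Set X) (γ : List ℕ → I → X), Q [] = univ ∧
      (∀ w, IsSplitting τ (Q w) (γ w) fun k => Q (k :: w)) ∧
      (∀ w, range (γ w) ∈ range (connectedComponent : X → Set X)) ∧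
      ∀ k w, diam (Q (k :: w)) ≤ diam (range (γ w)) + (1 / 2) ^ w.length := by
  have exists_splitting (Q : {Q : Set X // IsClopen Q ∧ Q.Nonempty}) (n : ℕ) :=
    h.exists_isSplitting hτ Q.2.1 Q.2.2 (δ := (1 / 2) ^ n) (by positivity)
  choose γ q hsplit hcomp hdiam using exists_splitting
  let node : List ℕ → {Q : Set X // IsClopen Q ∧ Q.Nonempty} := fun w =>
    List.rec ⟨univ, isClopen_univ, univ_nonempty⟩ (fun k w Q =>
      ⟨q Q w.length k, (hsplit Q w.length).isClopen k, (hsplit Q w.length).nonempty k⟩) w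
  exact ⟨fun w => (node w).1, fun w => γ (node w) w.length, rfl, fun w => hsplit _ _,
    fun w => hcomp _ _, fun k w => hdiam _ _ k⟩

end IsDecorated

section Uniqueness

variable {I X Y : Type*} [MetricSpace I] [MetricSpace X] [MetricSpace Y]

theorem injective_range_of_isBranch [Nonempty I] {τ : ℕ → I} {Q : List ℕ → Set X}
    {γ : List ℕ → I → X} (hsplit : ∀ w, IsSplitting τ (Q w) (γ w) fun k => Q (k :: w))
    {w : ℕ → List ℕ} (hw : IsBranch w) : Function.Injective fun n => range (γ (w n)) := by
  have hanti : Antitone fun n => Q (w n) := antitone_nat_of_succ_le fun n => by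
    obtain ⟨k, hk⟩ := hw.2 n
    exact hk ▸ (hsplit (w n)).child_subset k
  have hne {n m : ℕ} (hnm : n < m) : range (γ (w n)) ≠ range (γ (w m)) := fun heq => by
    obtain ⟨k, hk⟩ := hw.2 n
    obtain ⟨t, ht⟩ := heq.superset (mem_range_self (Classical.arbitrary I))
    have hmem : γ (w n) t ∈ Q (w (n + 1)) :=
      hanti hnm ((hsplit (w m)).range_subset (ht ▸ mem_range_self _))
    exact (hsplit (w n)).notMem_child t k (hk ▸ hmem)
  exact fun n m heq => (lt_trichotomy n m).elim (fun hlt => absurd heq (hne hlt))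
    (Or.elim · id fun hlt => absurd heq.symm (hne hlt))

theorem HasNullComponents.exists_diam_lt_of_isBranch [Nonempty I] (hX : HasNullComponents X)
    {τ : ℕ → I} {Q : List ℕ → Set X} {γ : List ℕ → I → X}
    (hsplit : ∀ w, IsSplitting τ (Q w) (γ w) fun k => Q (k :: w))
    (hcomp : ∀ w, range (γ w) ∈ range (connectedComponent : X → Set X))
    (hdiam : ∀ k w, diam (Q (k :: w)) ≤ diam (range (γ w)) + (1 / 2) ^ w.length)
    {w : ℕ → List ℕ} (hw : IsBranch w) {ε : ℝ} (hε : 0 < ε) : ∃ n, diam (Q (w n)) < ε := by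
  have hsmall : ∀ᶠ n in Filter.atTop, diam (range (γ (w n))) < ε / 2 := by
    rw [← Nat.cofinite_eq_atTop]
    refine ((hX (ε / 2) (half_pos hε)).preimage
      (injective_range_of_isBranch hsplit hw).injOn).subset fun n hn => ⟨hcomp _, not_lt.1 hn⟩
  have hpow : ∀ᶠ n in Filter.atTop, (1 / 2 : ℝ) ^ n < ε / 2 :=
    (tendsto_pow_atTop_nhds_zero_of_lt_one (by norm_num) (by norm_num)).eventually_lt_const
      (half_pos hε)
  obtain ⟨n, hn, hn'⟩ := (hsmall.and hpow).exists
  obtain ⟨k, hk⟩ := hw.2 n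
  have hd := hdiam k (w n)
  rw [← hk, hw.length_eq] at hd
  exact ⟨n + 1, by linarith⟩

variable [CompactSpace I] [CompactSpace X] [CompactSpace Y] [Nonempty I]

theorem IsDecorated.nonempty_decorationTree [Nonempty X] (h : IsDecorated I X) {τ : ℕ → I}
    (hτ : IsAccumulating τ) : Nonempty (DecorationTree I X τ) := by
  obtain ⟨Q, γ, hnil, hsplit, hcomp, hdiam⟩ := h.exists_iterated_isSplitting hτ
  exact ⟨⟨Q, γ, hnil, hsplit, fun _ hw _ hε =>
    h.null.exists_diam_lt_of_isBranch hsplit hcomp hdiam hw hε⟩⟩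

theorem IsDecorated.nonempty_homeomorph [Nonempty X] [Nonempty Y] (hX : IsDecorated I X)
    (hY : IsDecorated I Y) : Nonempty (X ≃ₜ Y) := by
  obtain ⟨τ, hτ⟩ := exists_isAccumulating I
  obtain ⟨T⟩ := hX.nonempty_decorationTree hτ
  obtain ⟨T'⟩ := hY.nonempty_decorationTree hτ
  exact T.nonempty_homeomorph T'

end Uniqueness

theorem isDecorated_unit_of_forall_nontrivial {X : Type*} [MetricSpace X]
    [TotallyDisconnectedSpace X] (h : ∀ U : Set X, IsOpen U → U.Nonempty → U.Nontrivial) :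
    IsDecorated Unit X where
  component x := Or.inl <| by
    rw [connectedComponent_eq_singleton]
    exact subsingleton_singleton
  null ε hε := by
    refine finite_empty.subset ?_
    rintro _ ⟨⟨x, rfl⟩, hx⟩
    rw [connectedComponent_eq_singleton, diam_singleton] at hx
    exact hε.not_ge hx
  dense U hU hne := by
    obtain ⟨x, hx, y, hy, hxy⟩ := h U hU hne
    have isCopyComponent (z : X) : IsCopyComponent Unit ({z} : Set X) :=
      ⟨⟨z, connectedComponent_eq_singleton z⟩, fun _ => z, continuous_const,
        Function.injective_of_subsingleton _, range_const⟩
    exact ⟨{x}, {y}, singleton_injective.ne hxy, isCopyComponent x, isCopyComponent y,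
      singleton_subset_iff.2 hx, singleton_subset_iff.2 hy⟩

section Plane

/-- The point of the plane with coordinates `a` and `b`. -/
def planePoint (a b : ℝ) : Plane := !₂[a, b]

@[simp] theorem planePoint_zero (a b : ℝ) : planePoint a b 0 = a := rfl

@[simp] theorem planePoint_one (a b : ℝ) : planePoint a b 1 = b := rfl

theorem plane_ext {x y : Plane} (h0 : x 0 = y 0) (h1 : x 1 = y 1) : x = y := by
  ext i
  fin_cases i
  exacts [h0, h1]

theorem planePoint_mem {A : Set Plane} {x : Plane} (hx : x ∈ A) {a b : ℝ} (h0 : x 0 = a)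
    (h1 : x 1 = b) : planePoint a b ∈ A := by
  rwa [← plane_ext (x := x) (y := planePoint a b) h0 h1]

theorem continuous_planePoint {X : Type*} [TopologicalSpace X] {f g : X → ℝ} (hf : Continuous f)
    (hg : Continuous g) : Continuous fun x => planePoint (f x) (g x) := by
  refine (PiLp.continuous_toLp 2 _).comp (continuous_pi fun i => ?_)
  fin_cases i
  exacts [hf, hg]

theorem continuous_coordinate (i : Fin 2) : Continuous fun x : Plane => x i :=
  PiLp.continuous_apply 2 _ i

variable {N : ℕ}

@[simp] theorem digitMap_zero (d : Fin N × Fin N) (x : Plane) :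
    digitMap N d x 0 = (x 0 + (d.1 : ℕ)) / N := by
  simp [digitMap, inv_mul_eq_div, add_div]

@[simp] theorem digitMap_one (d : Fin N × Fin N) (x : Plane) :
    digitMap N d x 1 = (x 1 + (d.2 : ℕ)) / N := by
  simp [digitMap, inv_mul_eq_div, add_div]

theorem exists_digitMap_coordinate_eq (d : Fin N × Fin N) (i : Fin 2) :
    ∃ j : Fin N, ∀ x : Plane, digitMap N d x i = (x i + (j : ℕ)) / N := by
  fin_cases i
  exacts [⟨d.1, digitMap_zero d⟩, ⟨d.2, digitMap_one d⟩]

theorem dist_digitMap (d : Fin N × Fin N) (x y : Plane) :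
    dist (digitMap N d x) (digitMap N d y) = (N : ℝ)⁻¹ * dist x y := by
  simp [digitMap, dist_smul₀]

/-- The fixed point of the digit map of `d`. -/
noncomputable def digitFixedPoint (d : Fin N × Fin N) : Plane :=
  planePoint ((d.1 : ℕ) / (N - 1 : ℝ)) ((d.2 : ℕ) / (N - 1 : ℝ))

theorem digitMap_digitFixedPoint (hN : 2 ≤ N) (d : Fin N × Fin N) :
    digitMap N d (digitFixedPoint d) = digitFixedPoint d := by
  have hN' : (2 : ℝ) ≤ N := by exact_mod_cast hN
  have h1 : (N - 1 : ℝ) ≠ 0 := by linarith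
  have h2 : (N : ℝ) ≠ 0 := by linarith
  refine plane_ext ?_ ?_ <;> simp [digitFixedPoint] <;> field_simp <;> ring

theorem digitFixedPoint_injective (hN : 2 ≤ N) :
    Function.Injective (digitFixedPoint : Fin N × Fin N → Plane) := by
  have hN' : (2 : ℝ) ≤ N := by exact_mod_cast hN
  have h1 : (N - 1 : ℝ) ≠ 0 := by linarith
  intro d e h
  have hfst := congrArg (fun x : Plane => x 0) h
  have hsnd := congrArg (fun x : Plane => x 1) h
  simp only [digitFixedPoint, planePoint_zero, planePoint_one, div_left_inj' h1, Nat.cast_inj]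
    at hfst hsnd
  exact Prod.ext (Fin.ext hfst) (Fin.ext hsnd)

end Plane

namespace IsFractalSquare

variable {N : ℕ} {D : Finset (Fin N × Fin N)} {K : Set Plane}

theorem digitMap_mem (hK : IsFractalSquare N D K) {d : Fin N × Fin N} (hd : d ∈ D) {x : Plane}
    (hx : x ∈ K) : digitMap N d x ∈ K := by
  rw [hK.eq_iUnion]
  exact mem_biUnion hd (mem_image_of_mem _ hx)

theorem exists_digitMap_eq (hK : IsFractalSquare N D K) {x : Plane} (hx : x ∈ K) :
    ∃ d ∈ D, ∃ y ∈ K, digitMap N d y = x := by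
  rw [hK.eq_iUnion] at hx
  simpa only [mem_iUnion, mem_image, exists_prop] using hx

theorem compactSpace (hK : IsFractalSquare N D K) : CompactSpace K :=
  isCompact_iff_compactSpace.1 hK.isCompact

theorem coordinate_mem_Icc (hK : IsFractalSquare N D K) (hN : 2 ≤ N) {x : Plane} (hx : x ∈ K)
    (i : Fin 2) : x i ∈ Icc (0 : ℝ) 1 := by
  have hN' : (2 : ℝ) ≤ N := by exact_mod_cast hN
  constructor
  · obtain ⟨m, hm, hmin⟩ := hK.isCompact.exists_isMinOn hK.nonempty
      (continuous_coordinate i).continuousOn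
    obtain ⟨d, -, y, hy, hyx⟩ := hK.exists_digitMap_eq hm
    obtain ⟨j, hj⟩ := exists_digitMap_coordinate_eq d i
    have hmy : m i * N = y i + (j : ℕ) := by rw [← hyx, hj, div_mul_cancel₀ _ (by positivity)]
    nlinarith [isMinOn_iff.1 hmin y hy, isMinOn_iff.1 hmin x hx, (j : ℕ).cast_nonneg (α := ℝ)]
  · obtain ⟨m, hm, hmax⟩ := hK.isCompact.exists_isMaxOn hK.nonempty
      (continuous_coordinate i).continuousOn
    obtain ⟨d, -, y, hy, hyx⟩ := hK.exists_digitMap_eq hm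
    obtain ⟨j, hj⟩ := exists_digitMap_coordinate_eq d i
    have hmy : m i * N = y i + (j : ℕ) := by rw [← hyx, hj, div_mul_cancel₀ _ (by positivity)]
    have hjN : ((j : ℕ) : ℝ) + 1 ≤ N := by exact_mod_cast j.isLt
    nlinarith [isMaxOn_iff.1 hmax y hy, isMaxOn_iff.1 hmax x hx]

theorem infDist_digitMap_le (hK : IsFractalSquare N D K) {d : Fin N × Fin N} (hd : d ∈ D)
    (x : Plane) : infDist (digitMap N d x) K ≤ (N : ℝ)⁻¹ * infDist x K := by
  obtain ⟨y, hy, hxy⟩ := hK.isCompact.exists_infDist_eq_dist hK.nonempty x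
  rw [hxy, ← dist_digitMap]
  exact infDist_le_dist_of_mem (hK.digitMap_mem hd hy)

theorem subset_of_subset_biUnion_digitMap (hK : IsFractalSquare N D K) (hN : 2 ≤ N)
    {A : Set Plane} (hA : IsCompact A) (h : A ⊆ ⋃ d ∈ D, digitMap N d '' A) : A ⊆ K := by
  have hN' : (2 : ℝ) ≤ N := by exact_mod_cast hN
  rcases A.eq_empty_or_nonempty with rfl | hne
  · exact empty_subset K
  obtain ⟨a, ha, hmax⟩ := hA.exists_isMaxOn hne (continuous_infDist_pt K).continuousOn
  obtain ⟨d, hd, b, hb, rfl⟩ := mem_iUnion₂.1 (h ha)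
  have hab := isMaxOn_iff.1 hmax b hb
  have hcontract := hK.infDist_digitMap_le hd b
  rw [inv_mul_eq_div, le_div_iff₀ (by positivity)] at hcontract
  have hzero : infDist (digitMap N d b) K ≤ 0 := by nlinarith [infDist_nonneg (x := b) (s := K)]
  intro x hx
  rw [hK.isCompact.isClosed.mem_iff_infDist_zero hK.nonempty]
  exact le_antisymm ((isMaxOn_iff.1 hmax x hx).trans hzero) infDist_nonneg

theorem digitFixedPoint_mem (hK : IsFractalSquare N D K) (hN : 2 ≤ N) {d : Fin N × Fin N}
    (hd : d ∈ D) : digitFixedPoint d ∈ K := by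
  refine singleton_subset_iff.1 (hK.subset_of_subset_biUnion_digitMap hN isCompact_singleton ?_)
  rw [singleton_subset_iff]
  exact mem_biUnion hd ⟨_, rfl, digitMap_digitFixedPoint hN d⟩

theorem nontrivial (hK : IsFractalSquare N D K) (hN : 2 ≤ N) (hD : D.Nontrivial) :
    K.Nontrivial := by
  obtain ⟨d, hd, e, he, hde⟩ := hD
  exact ⟨_, hK.digitFixedPoint_mem hN hd, _, hK.digitFixedPoint_mem hN he,
    (digitFixedPoint_injective hN).ne hde⟩

end IsFractalSquare

section Cells

variable {N : ℕ}

/-- The composition of the digit maps along a word. The head of the word is the digit applied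
first, so that consing a digit passes to a subcell. -/
noncomputable def cellMap : List (Fin N × Fin N) → Plane → Plane
  | [] => id
  | d :: w => cellMap w ∘ digitMap N d

/-- The integer position of the cell of a word, in units of its side length. -/
def address : List (Fin N × Fin N) → ℤ × ℤ
  | [] => 0
  | d :: w => (N * (address w).1 + (d.1 : ℕ), N * (address w).2 + (d.2 : ℕ))

theorem cellMap_append (u w : List (Fin N × Fin N)) (x : Plane) :
    cellMap (u ++ w) x = cellMap w (cellMap u x) := by
  induction u generalizing x with
  | nil => rfl
  | cons d _ ih => exact ih _

theorem cellMap_coordinates (w : List (Fin N × Fin N)) (x : Plane) :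
    (N : ℝ) ^ w.length * cellMap w x 0 = x 0 + (address w).1 ∧
      (N : ℝ) ^ w.length * cellMap w x 1 = x 1 + (address w).2 := by
  induction w generalizing x with
  | nil => simp [cellMap, address]
  | cons d w ih =>
    have hN : (N : ℝ) ≠ 0 := by exact_mod_cast d.1.pos.ne'
    obtain ⟨h0, h1⟩ := ih (digitMap N d x)
    simp only [digitMap_zero, digitMap_one] at h0 h1
    simp only [cellMap, Function.comp_apply, address, List.length_cons, pow_succ', mul_assoc, h0,
      h1]
    push_cast
    constructor <;> field_simp <;> ring

theorem dist_cellMap (w : List (Fin N × Fin N)) (x y : Plane) :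
    dist (cellMap w x) (cellMap w y) = ((N : ℝ) ^ w.length)⁻¹ * dist x y := by
  induction w generalizing x y with
  | nil => simp [cellMap]
  | cons d w ih =>
    simp only [cellMap, Function.comp_apply, ih, dist_digitMap, List.length_cons, pow_succ, mul_inv,
      mul_assoc]

theorem continuous_cellMap (w : List (Fin N × Fin N)) : Continuous (cellMap w) := by
  induction w with
  | nil => exact continuous_id
  | cons d w ih => exact ih.comp (lipschitzWith_digitMap N d).continuous

theorem cellMap_injective (w : List (Fin N × Fin N)) : Function.Injective (cellMap w) := by
  intro x y h
  obtain ⟨hx0, hx1⟩ := cellMap_coordinates w x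
  obtain ⟨hy0, hy1⟩ := cellMap_coordinates w y
  rw [h] at hx0 hx1
  exact plane_ext (by linarith) (by linarith)

/-- The words of length `n` with digits in `D`. -/
def words (D : Finset (Fin N × Fin N)) (n : ℕ) : Set (List (Fin N × Fin N)) :=
  {w | w.length = n ∧ ∀ d ∈ w, d ∈ D}

variable {D : Finset (Fin N × Fin N)}

theorem finite_words (D : Finset (Fin N × Fin N)) (n : ℕ) : (words D n).Finite :=
  (List.finite_length_eq _ n).subset fun _ hw => hw.1

theorem cons_mem_words {d : Fin N × Fin N} {w : List (Fin N × Fin N)} {n : ℕ} :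
    d :: w ∈ words D (n + 1) ↔ d ∈ D ∧ w ∈ words D n := by
  simp only [words, mem_ofPred_eq, List.length_cons, Nat.add_right_cancel_iff, List.forall_mem_cons]
  tauto

theorem exists_cons_of_mem_words_succ {w : List (Fin N × Fin N)} {n : ℕ}
    (hw : w ∈ words D (n + 1)) : ∃ d ∈ D, ∃ v ∈ words D n, w = d :: v := by
  obtain ⟨d, v, rfl⟩ := List.exists_cons_of_length_eq_add_one hw.1
  exact ⟨d, (cons_mem_words.1 hw).1, v, (cons_mem_words.1 hw).2, rfl⟩

theorem append_mem_words {u w : List (Fin N × Fin N)} {m n : ℕ} (hu : u ∈ words D m)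
    (hw : w ∈ words D n) : u ++ w ∈ words D (m + n) :=
  ⟨by rw [List.length_append, hu.1, hw.1],
    fun d hd => (List.mem_append.1 hd).elim (hu.2 d) (hw.2 d)⟩

namespace IsFractalSquare

variable {K : Set Plane}

theorem cellMap_mem (hK : IsFractalSquare N D K) {n : ℕ} {w : List (Fin N × Fin N)}
    (hw : w ∈ words D n) {x : Plane} (hx : x ∈ K) : cellMap w x ∈ K := by
  induction n generalizing w x with
  | zero => rwa [List.length_eq_zero_iff.1 hw.1]
  | succ n ih =>
    obtain ⟨d, hd, v, hv, rfl⟩ := exists_cons_of_mem_words_succ hw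
    exact ih hv (hK.digitMap_mem hd hx)

theorem exists_mem_cell (hK : IsFractalSquare N D K) {x : Plane} (hx : x ∈ K) (n : ℕ) :
    ∃ w ∈ words D n, x ∈ cellMap w '' K := by
  induction n with
  | zero => exact ⟨[], ⟨rfl, by simp⟩, x, hx, rfl⟩
  | succ n ih =>
    obtain ⟨w, hw, y, hy, rfl⟩ := ih
    obtain ⟨d, hd, z, hz, rfl⟩ := hK.exists_digitMap_eq hy
    exact ⟨d :: w, cons_mem_words.2 ⟨hd, hw⟩, z, hz, rfl⟩

theorem exists_forall_dist_cellMap_lt (hK : IsFractalSquare N D K) (hN : 2 ≤ N) {ε : ℝ}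
    (hε : 0 < ε) :
    ∃ n, ∀ w ∈ words D n, ∀ x ∈ K, ∀ y ∈ K, dist (cellMap w x) (cellMap w y) < ε := by
  have hN' : (1 : ℝ) < N := by exact_mod_cast hN
  obtain ⟨n, hn⟩ := pow_unbounded_of_one_lt (diam K / ε) hN'
  refine ⟨n, fun w hw x hx y hy => ?_⟩
  rw [dist_cellMap, hw.1, inv_mul_lt_iff₀ (by positivity)]
  rw [div_lt_iff₀ hε] at hn
  exact (dist_le_diam_of_mem hK.isCompact.isBounded hx hy).trans_lt hn

theorem exists_cell_subset_ball (hK : IsFractalSquare N D K) (hN : 2 ≤ N) {x : Plane} (hx : x ∈ K)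
    {ε : ℝ} (hε : 0 < ε) : ∃ n, ∃ w ∈ words D n, cellMap w '' K ⊆ ball x ε := by
  obtain ⟨n, hn⟩ := hK.exists_forall_dist_cellMap_lt hN hε
  obtain ⟨w, hw, y, hy, rfl⟩ := hK.exists_mem_cell hx n
  exact ⟨n, w, hw, image_subset_iff.2 fun z hz => hn w hw z hz y hy⟩

end IsFractalSquare

end Cells

section Labels

theorem label_eq_of_isPreconnected {X ι J : Type*} [TopologicalSpace X] [Finite ι] {F : ι → Set X}
    (hF : ∀ i, IsClosed (F i)) {l : ι → J} (hl : ∀ i j, (F i ∩ F j).Nonempty → l i = l j)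
    {C : Set X} (hC : IsPreconnected C) (hCF : C ⊆ ⋃ i, F i) {x y : X} (hx : x ∈ C) (hy : y ∈ C)
    {i j : ι} (hxi : x ∈ F i) (hyj : y ∈ F j) : l i = l j := by
  by_contra hne
  have hclosed : ∀ P : ι → Prop, IsClosed (⋃ k : {k // P k}, F k) := fun P =>
    isClosed_iUnion_of_finite fun k => hF k
  have hcover : C ⊆ (⋃ k : {k // l k = l i}, F k) ∪ ⋃ k : {k // l k ≠ l i}, F k := by
    intro z hz
    obtain ⟨k, hk⟩ := mem_iUnion.1 (hCF hz)
    by_cases h : l k = l i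
    · exact Or.inl (mem_iUnion_of_mem ⟨k, h⟩ hk)
    · exact Or.inr (mem_iUnion_of_mem ⟨k, h⟩ hk)
  obtain ⟨z, -, hz, hz'⟩ := isPreconnected_closed_iff.1 hC _ _ (hclosed _) (hclosed _) hcover
    ⟨x, hx, mem_iUnion_of_mem ⟨i, rfl⟩ hxi⟩ ⟨y, hy, mem_iUnion_of_mem ⟨j, Ne.symm hne⟩ hyj⟩
  obtain ⟨⟨a, ha⟩, hza⟩ := mem_iUnion.1 hz
  obtain ⟨⟨b, hb⟩, hzb⟩ := mem_iUnion.1 hz'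
  exact hb ((hl b a ⟨z, hzb, hza⟩).trans ha)

variable {N : ℕ}

/-- The relative position of the subcells `d` and `e` of two cells in relative position `s`. -/
def carry (s : ℤ × ℤ) (d e : Fin N × Fin N) : ℤ × ℤ :=
  (N * s.1 + (e.1 : ℕ) - (d.1 : ℕ), N * s.2 + (e.2 : ℕ) - (d.2 : ℕ))

theorem address_cons_sub_address_cons (d e : Fin N × Fin N) (w v : List (Fin N × Fin N)) :
    address (e :: v) - address (d :: w) = carry (address v - address w) d e := by
  ext <;> simp only [address, carry, Prod.fst_sub, Prod.snd_sub] <;> ring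

theorem coordinates_sub_eq_address_sub {w v : List (Fin N × Fin N)} (hlen : w.length = v.length)
    {x y : Plane} (h : cellMap w x = cellMap v y) :
    x 0 - y 0 = (address v - address w).1 ∧ x 1 - y 1 = (address v - address w).2 := by
  obtain ⟨hx0, hx1⟩ := cellMap_coordinates w x
  obtain ⟨hy0, hy1⟩ := cellMap_coordinates v y
  rw [h, hlen] at hx0 hx1
  rw [Prod.fst_sub, Prod.snd_sub]
  push_cast
  constructor <;> linarith

variable {D : Finset (Fin N × Fin N)}

/-- A decidable necessary condition, sharper for larger `n`, for the fractal square with digit set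
`D` to meet its translate by `t`: it looks at the cells of the first `n` generations. -/
def MayMeet (D : Finset (Fin N × Fin N)) : ℕ → ℤ × ℤ → Prop
  | 0, t => |t.1| ≤ 1 ∧ |t.2| ≤ 1
  | n + 1, t => (|t.1| ≤ 1 ∧ |t.2| ≤ 1) ∧ ∃ d ∈ D, ∃ e ∈ D, MayMeet D n (carry t d e)

instance MayMeet.decidable (D : Finset (Fin N × Fin N)) :
    ∀ (n : ℕ) (t : ℤ × ℤ), Decidable (MayMeet D n t)
  | 0, t => inferInstanceAs (Decidable (|t.1| ≤ 1 ∧ |t.2| ≤ 1))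
  | n + 1, t =>
    haveI := MayMeet.decidable D n
    inferInstanceAs (Decidable ((|t.1| ≤ 1 ∧ |t.2| ≤ 1) ∧
      ∃ d ∈ D, ∃ e ∈ D, MayMeet D n (carry t d e)))

/-- A certificate for the linear form `φ` to be constant on the connected subsets of the fractal
square. The set `S` contains the relative positions of all touching cells of equal size, and
correcting the value of `φ` at a cell by the entry of the table `c` at the last digit of the cell
gives the same label to touching cells. -/
def IsLabelling (D : Finset (Fin N × Fin N)) (S : Finset (ℤ × ℤ)) (φ : ℤ × ℤ)
    (c : Matrix (Fin N) (Fin N) ℤ) : Prop :=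
  0 ∈ S ∧ ∀ s ∈ S, ∀ d ∈ D, ∀ e ∈ D, MayMeet D 3 (carry s d e) →
    carry s d e ∈ S ∧ φ.1 * (carry s d e).1 + φ.2 * (carry s d e).2 + c e.1 e.2 = c d.1 d.2

instance (D : Finset (Fin N × Fin N)) (S : Finset (ℤ × ℤ)) (φ : ℤ × ℤ)
    (c : Matrix (Fin N) (Fin N) ℤ) : Decidable (IsLabelling D S φ c) :=
  inferInstanceAs (Decidable (_ ∧ _))

/-- The linear form `φ` is constant on the connected subsets of `K`. -/
def IsComponentwiseConstant (K : Set Plane) (φ : ℤ × ℤ) : Prop :=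
  ∀ C ⊆ K, IsPreconnected C → ∀ x ∈ C, ∀ y ∈ C, φ.1 * x 0 + φ.2 * x 1 = φ.1 * y 0 + φ.2 * y 1

variable {K : Set Plane}

namespace IsFractalSquare

theorem abs_coordinate_sub_le_one (hK : IsFractalSquare N D K) (hN : 2 ≤ N) {x y : Plane}
    (hx : x ∈ K) (hy : y ∈ K) (i : Fin 2) : |x i - y i| ≤ 1 := by
  obtain ⟨hx0, hx1⟩ := hK.coordinate_mem_Icc hN hx i
  obtain ⟨hy0, hy1⟩ := hK.coordinate_mem_Icc hN hy i
  rw [abs_le]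
  constructor <;> linarith

theorem mayMeet (hK : IsFractalSquare N D K) (hN : 2 ≤ N) (n : ℕ) {t : ℤ × ℤ} {x y : Plane}
    (hx : x ∈ K) (hy : y ∈ K) (h0 : x 0 - y 0 = t.1) (h1 : x 1 - y 1 = t.2) : MayMeet D n t := by
  have hunit : |t.1| ≤ 1 ∧ |t.2| ≤ 1 := by
    rify
    rw [← h0, ← h1]
    exact ⟨hK.abs_coordinate_sub_le_one hN hx hy 0, hK.abs_coordinate_sub_le_one hN hx hy 1⟩
  induction n generalizing t x y with
  | zero => exact hunit
  | succ n ih =>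
    obtain ⟨d, hd, x', hx', rfl⟩ := hK.exists_digitMap_eq hx
    obtain ⟨e, he, y', hy', rfl⟩ := hK.exists_digitMap_eq hy
    have hN0 : (N : ℝ) ≠ 0 := by positivity
    simp only [digitMap_zero, digitMap_one] at h0 h1
    field_simp at h0 h1
    have h0' : x' 0 - y' 0 = (carry t d e).1 := by simp only [carry]; push_cast; linarith
    have h1' : x' 1 - y' 1 = (carry t d e).2 := by simp only [carry]; push_cast; linarith
    refine ⟨hunit, d, hd, e, he, ih hx' hy' h0' h1' ?_⟩
    rify
    rw [← h0', ← h1']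
    exact ⟨hK.abs_coordinate_sub_le_one hN hx' hy' 0, hK.abs_coordinate_sub_le_one hN hx' hy' 1⟩

theorem mayMeet_of_cellMap_eq (hK : IsFractalSquare N D K) (hN : 2 ≤ N) (m : ℕ)
    {w v : List (Fin N × Fin N)} (hlen : w.length = v.length) {x y : Plane} (hx : x ∈ K)
    (hy : y ∈ K) (h : cellMap w x = cellMap v y) : MayMeet D m (address v - address w) :=
  hK.mayMeet hN m hx hy (coordinates_sub_eq_address_sub hlen h).1
    (coordinates_sub_eq_address_sub hlen h).2

variable {S : Finset (ℤ × ℤ)} {φ : ℤ × ℤ} {c : Matrix (Fin N) (Fin N) ℤ}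

theorem address_sub_mem (hK : IsFractalSquare N D K) (hN : 2 ≤ N) (hc : IsLabelling D S φ c)
    {n : ℕ} {w v : List (Fin N × Fin N)} (hw : w ∈ words D n) (hv : v ∈ words D n) {x y : Plane}
    (hx : x ∈ K) (hy : y ∈ K) (h : cellMap w x = cellMap v y) : address v - address w ∈ S := by
  induction n generalizing w v x y with
  | zero => simpa [List.length_eq_zero_iff.1 hw.1, List.length_eq_zero_iff.1 hv.1] using hc.1
  | succ n ih =>
    have hmeet := hK.mayMeet_of_cellMap_eq hN 3 (hw.1.trans hv.1.symm) hx hy h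
    obtain ⟨d, hd, w', hw', rfl⟩ := exists_cons_of_mem_words_succ hw
    obtain ⟨e, he, v', hv', rfl⟩ := exists_cons_of_mem_words_succ hv
    rw [address_cons_sub_address_cons] at hmeet ⊢
    exact (hc.2 _ (ih hw' hv' (hK.digitMap_mem hd hx) (hK.digitMap_mem he hy) h) d hd e he hmeet).1

end IsFractalSquare

/-- The label of a cell given by a table of corrections to the linear form `φ`. -/
def cellLabel (φ : ℤ × ℤ) (c : Matrix (Fin N) (Fin N) ℤ) : List (Fin N × Fin N) → ℤ
  | [] => 0
  | d :: w => φ.1 * (address (d :: w)).1 + φ.2 * (address (d :: w)).2 + c d.1 d.2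

namespace IsFractalSquare

variable {S : Finset (ℤ × ℤ)} {φ : ℤ × ℤ} {c : Matrix (Fin N) (Fin N) ℤ}

theorem cellLabel_eq (hK : IsFractalSquare N D K) (hN : 2 ≤ N) (hc : IsLabelling D S φ c) {n : ℕ}
    {w v : List (Fin N × Fin N)} (hw : w ∈ words D (n + 1)) (hv : v ∈ words D (n + 1)) {x y : Plane}
    (hx : x ∈ K) (hy : y ∈ K) (h : cellMap w x = cellMap v y) :
    cellLabel φ c w = cellLabel φ c v := by
  have hmeet := hK.mayMeet_of_cellMap_eq hN 3 (hw.1.trans hv.1.symm) hx hy h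
  obtain ⟨d, hd, w', hw', rfl⟩ := exists_cons_of_mem_words_succ hw
  obtain ⟨e, he, v', hv', rfl⟩ := exists_cons_of_mem_words_succ hv
  rw [address_cons_sub_address_cons] at hmeet
  have hagree := (hc.2 _ (hK.address_sub_mem hN hc hw' hv' (hK.digitMap_mem hd hx)
    (hK.digitMap_mem he hy) h) d hd e he hmeet).2
  rw [← address_cons_sub_address_cons, Prod.fst_sub, Prod.snd_sub] at hagree
  simp only [cellLabel]
  linarith

theorem abs_linearForm_sub_cellLabel_le (hK : IsFractalSquare N D K) (hN : 2 ≤ N) {n : ℕ}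
    {w : List (Fin N × Fin N)} (hw : w ∈ words D (n + 1)) {x : Plane} (hx : x ∈ K) :
    |N ^ (n + 1) * (φ.1 * cellMap w x 0 + φ.2 * cellMap w x 1) - cellLabel φ c w| ≤
      |(φ.1 : ℝ)| + |(φ.2 : ℝ)| + ∑ i, ∑ j, |(c i j : ℝ)| := by
  obtain ⟨h0, h1⟩ := cellMap_coordinates w x
  rw [hw.1] at h0 h1
  obtain ⟨d, -, w, -, rfl⟩ := exists_cons_of_mem_words_succ hw
  have hform : N ^ (n + 1) * (φ.1 * cellMap (d :: w) x 0 + φ.2 * cellMap (d :: w) x 1) -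
      cellLabel φ c (d :: w) = φ.1 * x 0 + φ.2 * x 1 - c d.1 d.2 := by
    simp only [cellLabel]
    push_cast
    linear_combination (φ.1 : ℝ) * h0 + (φ.2 : ℝ) * h1
  have hcoord : ∀ (a : ℤ) (i : Fin 2), |(a : ℝ) * x i| ≤ |(a : ℝ)| := fun a i => by
    obtain ⟨hi0, hi1⟩ := hK.coordinate_mem_Icc hN hx i
    rw [abs_mul, abs_of_nonneg hi0]
    exact mul_le_of_le_one_right (abs_nonneg _) hi1
  have htable : |(c d.1 d.2 : ℝ)| ≤ ∑ i, ∑ j, |(c i j : ℝ)| :=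
    (Finset.single_le_sum (f := fun j => |(c d.1 j : ℝ)|) (fun j _ => abs_nonneg _)
      (Finset.mem_univ d.2)).trans
    (Finset.single_le_sum (f := fun i => ∑ j, |(c i j : ℝ)|)
      (fun i _ => Finset.sum_nonneg fun j _ => abs_nonneg _) (Finset.mem_univ d.1))
  rw [hform]
  exact (abs_sub _ _).trans
    (add_le_add ((abs_add_le _ _).trans (add_le_add (hcoord _ 0) (hcoord _ 1))) htable)

theorem isComponentwiseConstant (hK : IsFractalSquare N D K) (hN : 2 ≤ N)
    (hc : IsLabelling D S φ c) : IsComponentwiseConstant K φ := by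
  intro C hCK hC x hx y hy
  set M : ℝ := |(φ.1 : ℝ)| + |(φ.2 : ℝ)| + ∑ i, ∑ j, |(c i j : ℝ)|
  have hbound (n : ℕ) :
      N ^ (n + 1) * |(φ.1 * x 0 + φ.2 * x 1) - (φ.1 * y 0 + φ.2 * y 1)| ≤ 2 * M := by
    let F : words D (n + 1) → Set Plane := fun w => cellMap w.1 '' K
    have hcover : ∀ z ∈ C, ∃ w, z ∈ F w := fun z hz => by
      obtain ⟨w, hw, hzw⟩ := hK.exists_mem_cell (hCK hz) (n + 1)
      exact ⟨⟨w, hw⟩, hzw⟩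
    obtain ⟨w, x', hx', rfl⟩ := hcover x hx
    obtain ⟨v, y', hy', rfl⟩ := hcover y hy
    have := (finite_words D (n + 1)).to_subtype
    have hlabel : cellLabel φ c w = cellLabel φ c v :=
      label_eq_of_isPreconnected (F := F) (l := fun w => cellLabel φ c w)
        (fun w => (hK.isCompact.image (continuous_cellMap w.1)).isClosed)
        (by
          rintro ⟨w, hw⟩ ⟨v, hv⟩ ⟨_, ⟨a, ha, rfl⟩, b, hb, hab⟩
          exact hK.cellLabel_eq hN hc hw hv ha hb hab.symm)
        hC (fun z hz => mem_iUnion.2 (hcover z hz)) hx hy (mem_image_of_mem _ hx')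
        (mem_image_of_mem _ hy')
    have hw := abs_le.1 (hK.abs_linearForm_sub_cellLabel_le (φ := φ) (c := c) hN w.2 hx')
    have hv := abs_le.1 (hK.abs_linearForm_sub_cellLabel_le (φ := φ) (c := c) hN v.2 hy')
    rw [hlabel] at hw
    rw [← abs_of_nonneg (show (0 : ℝ) ≤ N ^ (n + 1) by positivity), ← abs_mul, mul_sub, abs_le]
    constructor <;> linarith [hw.1, hw.2, hv.1, hv.2]
  by_contra hne
  have hN' : (1 : ℝ) < N := by exact_mod_cast hN
  have hpos := abs_pos.2 (sub_ne_zero.2 hne)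
  obtain ⟨n, hn⟩ := pow_unbounded_of_one_lt (2 * M / _) hN'
  rw [div_lt_iff₀ hpos] at hn
  exact absurd (hbound n) (not_le.2 (hn.trans_le (by gcongr; exacts [hN'.le, n.le_succ])))

end IsFractalSquare

end Labels

section StackCrossings

/-- Over every interior column position `u` the line of slope `σ` and intercept `t` meets the
vertical stack of integer translates of `K`. -/
def IsStackCrossing (K : Set Plane) (σ : ℤ) (t : ℝ) : Prop :=
  ∀ u ∈ Ioo (0 : ℝ) 1, ∃ j : ℤ, planePoint u (σ * u + t - j) ∈ K

theorem eq_of_mem_Icc_of_add_intCast_eq {a b : ℤ} {u v : ℝ} (hu : u ∈ Ioo (0 : ℝ) 1)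
    (hv : v ∈ Icc (0 : ℝ) 1) (h : v + b = u + a) : b = a := by
  have h1 : (b : ℝ) < a + 1 := by linarith [hv.1, hu.2]
  have h2 : (a : ℝ) < b + 1 := by linarith [hv.2, hu.1]
  norm_cast at h1 h2
  omega

theorem IsStackCrossing.sub_intCast {K : Set Plane} {σ : ℤ} {t : ℝ} (ht : IsStackCrossing K σ t)
    (n : ℤ) : IsStackCrossing K σ (t - n) := fun u hu => by
  obtain ⟨j, hj⟩ := ht u hu
  refine ⟨j - n, ?_⟩
  push_cast
  convert hj using 2
  ring

variable {N : ℕ} {D : Finset (Fin N × Fin N)} {K : Set Plane}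

namespace IsFractalSquare

theorem exists_row_of_mem_column (hK : IsFractalSquare N D K) (hN : 2 ≤ N) {i : Fin N} {u y : ℝ}
    (hu : u ∈ Ioo (0 : ℝ) 1) (h : planePoint ((u + (i : ℕ)) / N) y ∈ K) :
    ∃ j, (i, j) ∈ D ∧ planePoint u (N * y - (j : ℕ)) ∈ K := by
  have hN0 : (N : ℝ) ≠ 0 := by positivity
  obtain ⟨⟨i', j⟩, hd, x, hx, hxy⟩ := hK.exists_digitMap_eq h
  have h0 := congrArg (fun z : Plane => z 0) hxy
  have h1 := congrArg (fun z : Plane => z 1) hxy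
  simp only [digitMap_zero, digitMap_one, planePoint_zero, planePoint_one,
    div_left_inj' hN0] at h0 h1
  have hi : ((i' : ℕ) : ℤ) = (i : ℕ) :=
    eq_of_mem_Icc_of_add_intCast_eq hu (hK.coordinate_mem_Icc hN hx 0) (by exact_mod_cast h0)
  obtain rfl : i' = i := Fin.ext (by exact_mod_cast hi)
  exact ⟨j, hd, planePoint_mem hx (by simpa using h0) (by simp [← h1, mul_div_cancel₀ _ hN0])⟩

theorem exists_digit_of_isStackCrossing (hK : IsFractalSquare N D K) (hN : 2 ≤ N) {σ : ℤ} {t : ℝ}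
    (ht : IsStackCrossing K σ t) (i : Fin N) {u : ℝ} (hu : u ∈ Ioo (0 : ℝ) 1) :
    ∃ m : ℤ, planePoint u (σ * u + N * t - m) ∈ K ∧
      ∃ b, (i, b) ∈ D ∧ (N : ℤ) ∣ m + σ * (i : ℕ) - (b : ℕ) := by
  have hN' : (0 : ℝ) < N := by positivity
  have hi : ((i : ℕ) : ℝ) + 1 ≤ N := by exact_mod_cast i.isLt
  obtain ⟨j, hj⟩ := ht ((u + (i : ℕ)) / N)
    ⟨by have := hu.1; positivity, by rw [div_lt_one hN']; linarith [hu.2]⟩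
  obtain ⟨b, hb, hmem⟩ := hK.exists_row_of_mem_column hN hu hj
  refine ⟨N * j + (b : ℕ) - σ * (i : ℕ), ?_, b, hb, j, by ring⟩
  convert hmem using 2
  push_cast
  field_simp
  ring

theorem isStackCrossing_natCast_mul (hK : IsFractalSquare N D K) (hN : 2 ≤ N) {σ : ℤ} {t : ℝ}
    (ht : IsStackCrossing K σ t) : IsStackCrossing K σ (N * t) := fun u hu => by
  obtain ⟨m, hm, -⟩ := hK.exists_digit_of_isStackCrossing hN ht ⟨0, by omega⟩ hu
  exact ⟨m, hm⟩

theorem exists_isStackCrossing (hK : IsFractalSquare N D K) (hN : 2 ≤ N) {C : Set Plane}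
    (hC : IsPreconnected C) (hCK : C ⊆ K) {σ : ℤ} {h : ℝ} (hσ : ∀ z ∈ C, z 1 = σ * z 0 + h) {k : ℕ}
    {x y : Plane} (hx : x ∈ C) (hy : y ∈ C) (hxy : x 0 + 2 / N ^ k < y 0) :
    ∃ a : ℤ, (∀ u ∈ Ioo (0 : ℝ) 1,
      planePoint ((a + u) / N ^ k) (σ * ((a + u) / N ^ k) + h) ∈ C) ∧
        IsStackCrossing K σ (N ^ k * h + σ * a) := by
  have hpos : (0 : ℝ) < N ^ k := by positivity
  set a : ℤ := ⌈N ^ k * x 0⌉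
  have ha : N ^ k * x 0 ≤ a := Int.le_ceil _
  have ha' : (a : ℝ) < N ^ k * x 0 + 1 := Int.ceil_lt_add_one _
  have hline : ∀ u ∈ Ioo (0 : ℝ) 1,
      planePoint ((a + u) / N ^ k) (σ * ((a + u) / N ^ k) + h) ∈ C := fun u hu => by
    have hbetween : (a + u) / N ^ k ∈ Icc (x 0) (y 0) := by
      rw [mem_Icc, le_div_iff₀ hpos, div_le_iff₀ hpos]
      rw [← lt_sub_iff_add_lt', div_lt_iff₀ hpos] at hxy
      constructor <;> linarith [hu.1, hu.2]
    obtain ⟨z, hz, hz0⟩ := (hC.image _ (continuous_coordinate 0).continuousOn).ordConnected.out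
      (mem_image_of_mem _ hx) (mem_image_of_mem _ hy) hbetween
    exact planePoint_mem hz hz0 (by rw [hσ z hz]; exact hz0 ▸ rfl)
  refine ⟨a, hline, fun u hu => ?_⟩
  obtain ⟨w, hw, z, hz, hwz⟩ := hK.exists_mem_cell (hCK (hline u hu)) k
  obtain ⟨h0, h1⟩ := cellMap_coordinates w z
  simp only [hwz, hw.1, planePoint_zero, planePoint_one, mul_add, mul_left_comm _ (σ : ℝ),
    mul_div_cancel₀ _ hpos.ne'] at h0 h1
  have hwa := eq_of_mem_Icc_of_add_intCast_eq hu (hK.coordinate_mem_Icc hN hz 0)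
    (by linarith : z 0 + (address w).1 = u + a)
  rw [hwa] at h0
  exact ⟨(address w).2, planePoint_mem hz (by linarith) (by linarith)⟩

end IsFractalSquare

section Slopes

namespace IsFractalSquare

theorem exists_intCast_eq_of_isStackCrossing_one (hK : IsFractalSquare N D K) (hN : 2 ≤ N)
    {i b : Fin N} (hb : ∀ j, (i, j) ∈ D → j = b) {t : ℝ} (ht : IsStackCrossing K 1 t) :
    ∃ n : ℤ, N * t = n ∧ (N : ℤ) ∣ n + (i : ℕ) - (b : ℕ) := by
  have hdigit : ∀ u ∈ Ioo (0 : ℝ) 1, ∃ m : ℤ, u + N * t - m ∈ Icc (0 : ℝ) 1 ∧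
      (N : ℤ) ∣ m + (i : ℕ) - (b : ℕ) := fun u hu => by
    obtain ⟨m, hm, j, hj, hdvd⟩ := hK.exists_digit_of_isStackCrossing hN ht i hu
    rw [hb j hj] at hdvd
    refine ⟨m, ?_, by simpa using hdvd⟩
    simpa using hK.coordinate_mem_Icc hN hm 1
  have hfract : Int.fract (N * t) = 0 := by
    -- Otherwise the line leaves the unit square within the column, and the two integer parts that
    -- occur are consecutive and congruent modulo `N`.
    by_contra hne
    have hpos := lt_of_le_of_ne (Int.fract_nonneg _) (Ne.symm hne)
    have hlt := Int.fract_lt_one (N * t)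
    have hfloor := Int.floor_add_fract (N * t)
    set f := Int.fract (N * t)
    obtain ⟨m, hm, hdvd⟩ := hdigit ((1 - f) / 2) ⟨by linarith, by linarith⟩
    obtain ⟨m', hm', hdvd'⟩ := hdigit (1 - f / 2) ⟨by linarith, by linarith⟩
    have hmfloor : m = ⌊N * t⌋ := eq_of_mem_Icc_of_add_intCast_eq
      (u := (1 + f) / 2) ⟨by linarith, by linarith⟩ hm (by linarith)
    have hmfloor' : m' = ⌊N * t⌋ + 1 := eq_of_mem_Icc_of_add_intCast_eq
      (u := f / 2) ⟨by linarith, by linarith⟩ hm' (by push_cast; linarith)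
    have hone : (N : ℤ) ∣ 1 := by
      have := dvd_sub hdvd' hdvd
      rwa [show m' + (i : ℕ) - (b : ℕ) - (m + (i : ℕ) - (b : ℕ)) = 1 by omega] at this
    have := Int.le_of_dvd one_pos hone
    omega
  have hfloor := Int.floor_add_fract (N * t)
  rw [hfract, add_zero] at hfloor
  obtain ⟨m, hm, hdvd⟩ := hdigit (1 / 2) ⟨by norm_num, by norm_num⟩
  have hmfloor : m = ⌊N * t⌋ := eq_of_mem_Icc_of_add_intCast_eq
    (u := 1 / 2) ⟨by norm_num, by norm_num⟩ hm (by linarith)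
  exact ⟨m, by rw [hmfloor, hfloor], hdvd⟩

theorem not_isStackCrossing_one (hK : IsFractalSquare N D K) (hN : 2 ≤ N) {i b : Fin N}
    (hb : ∀ j, (i, j) ∈ D → j = b) (hib : i ≠ b) (t : ℝ) : ¬ IsStackCrossing K 1 t := by
  intro ht
  obtain ⟨n, hn, -⟩ := hK.exists_intCast_eq_of_isStackCrossing_one hN hb ht
  obtain ⟨n', hn', hdvd⟩ := hK.exists_intCast_eq_of_isStackCrossing_one hN hb
    (hK.isStackCrossing_natCast_mul hN ht)
  rw [hn] at hn'
  obtain rfl : N * n = n' := by exact_mod_cast hn'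
  rw [add_sub_assoc, dvd_add_right (dvd_mul_right _ _)] at hdvd
  have := Int.eq_zero_of_abs_lt_dvd hdvd (by rw [abs_lt]; omega)
  omega

end IsFractalSquare

end Slopes

section Rows

variable {r : Fin N}

namespace IsFractalSquare

theorem eq_row_of_line_subset (hK : IsFractalSquare N D K) (hN : 2 ≤ N)
    (hr : ∀ j, (∀ i, (i, j) ∈ D) → j = r) {t : ℝ} (ht : ∀ u ∈ Ioo (0 : ℝ) 1, planePoint u t ∈ K)
    {b : Fin N} (hb : ∀ j : Fin N, N * t - (j : ℕ) ∈ Icc (0 : ℝ) 1 → j = b) : b = r := by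
  have hN' : (0 : ℝ) < N := by positivity
  refine hr b fun i => ?_
  have hi : ((i : ℕ) : ℝ) + 1 ≤ N := by exact_mod_cast i.isLt
  obtain ⟨j, hj, hmem⟩ := hK.exists_row_of_mem_column hN (i := i) (u := 1 / 2) (y := t)
    ⟨by norm_num, by norm_num⟩ (ht _ ⟨by positivity, by rw [div_lt_one hN']; linarith⟩)
  rwa [← hb j (hK.coordinate_mem_Icc hN hmem 1)]

theorem row_eq_zero_of_bottom_subset (hK : IsFractalSquare N D K) (hN : 2 ≤ N)
    (hr : ∀ j, (∀ i, (i, j) ∈ D) → j = r) (h : ∀ u ∈ Ioo (0 : ℝ) 1, planePoint u 0 ∈ K) :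
    (r : ℕ) = 0 := by
  rw [← hK.eq_row_of_line_subset hN hr h (b := ⟨0, by omega⟩)]
  rintro j ⟨hj, -⟩
  rw [mul_zero, zero_sub, neg_nonneg] at hj
  exact Fin.ext (by exact_mod_cast le_antisymm hj (Nat.cast_nonneg _))

theorem row_add_one_eq_of_top_subset (hK : IsFractalSquare N D K) (hN : 2 ≤ N)
    (hr : ∀ j, (∀ i, (i, j) ∈ D) → j = r) (h : ∀ u ∈ Ioo (0 : ℝ) 1, planePoint u 1 ∈ K) :
    (r : ℕ) + 1 = N := by
  rw [← hK.eq_row_of_line_subset hN hr h (b := ⟨N - 1, by omega⟩)]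
  · exact Nat.sub_add_cancel (by omega)
  rintro j ⟨-, hj⟩
  rw [mul_one, sub_le_iff_le_add] at hj
  have hj' : N ≤ 1 + (j : ℕ) := by exact_mod_cast hj
  exact Fin.ext (by simp only; omega)

end IsFractalSquare

theorem row_height_mem_Icc (hN : 2 ≤ N) (r : Fin N) :
    (r : ℕ) / (N - 1 : ℝ) ∈ Icc (0 : ℝ) 1 := by
  have hN' : (2 : ℝ) ≤ N := by exact_mod_cast hN
  have hr : ((r : ℕ) : ℝ) + 1 ≤ N := by exact_mod_cast r.isLt
  have hN1 : (0 : ℝ) < N - 1 := by linarith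
  exact ⟨by positivity, by rw [div_le_one hN1]; linarith⟩

theorem dvd_sub_row (hN : 2 ≤ N) (hr : ∀ j, (∀ i, (i, j) ∈ D) → j = r) {m : ℤ}
    (h : ∀ i, ∃ b, (i, b) ∈ D ∧ (N : ℤ) ∣ m - (b : ℕ)) : (N : ℤ) ∣ m - (r : ℕ) := by
  obtain ⟨b, -, hb⟩ := h ⟨0, by omega⟩
  rwa [← hr b fun i => ?_]
  obtain ⟨b', hb', hdvd⟩ := h i
  have := Int.eq_zero_of_abs_lt_dvd (dvd_sub hb hdvd) (by rw [abs_lt]; omega)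
  rwa [show b = b' from Fin.ext (by omega)]

namespace IsFractalSquare

theorem exists_eq_add_of_mul_eq_intCast (hK : IsFractalSquare N D K) (hN : 2 ≤ N)
    (hr : ∀ j, (∀ i, (i, j) ∈ D) → j = r) {t : ℝ} (ht : IsStackCrossing K 0 t) {n : ℤ}
    (hn : N * t = n) : ∃ j : ℤ, t = j + (r : ℕ) / (N - 1 : ℝ) := by
  have hN' : (2 : ℝ) ≤ N := by exact_mod_cast hN
  have hcases : ∀ i, ∀ u ∈ Ioo (0 : ℝ) 1,
      (planePoint u 0 ∈ K ∧ ∃ b, (i, b) ∈ D ∧ (N : ℤ) ∣ n - (b : ℕ)) ∨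
        (planePoint u 1 ∈ K ∧ ∃ b, (i, b) ∈ D ∧ (N : ℤ) ∣ n - 1 - (b : ℕ)) := fun i u hu => by
    obtain ⟨m, hm, hdigit⟩ := hK.exists_digit_of_isStackCrossing hN ht i hu
    simp only [Int.cast_zero, zero_mul, zero_add, hn, add_zero] at hm hdigit
    have hnm := hK.coordinate_mem_Icc hN hm 1
    rw [planePoint_one, ← Int.cast_sub, ← Int.cast_zero, ← Int.cast_one] at hnm
    have h0 : 0 ≤ n - m := Int.cast_le.1 hnm.1
    have h1 : n - m ≤ 1 := Int.cast_le.1 hnm.2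
    rcases (by omega : m = n ∨ m = n - 1) with rfl | rfl
    · exact Or.inl ⟨by simpa using hm, hdigit⟩
    · exact Or.inr ⟨by simpa using hm, hdigit⟩
  by_cases hbottom : ∀ u ∈ Ioo (0 : ℝ) 1, planePoint u 0 ∈ K <;>
    by_cases htop : ∀ u ∈ Ioo (0 : ℝ) 1, planePoint u 1 ∈ K
  · have := hK.row_eq_zero_of_bottom_subset hN hr hbottom
    have := hK.row_add_one_eq_of_top_subset hN hr htop
    omega
  · push Not at htop
    obtain ⟨u, hu, hmem⟩ := htop
    obtain ⟨q, hq⟩ := dvd_sub_row hN hr fun i =>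
      ((hcases i u hu).resolve_right fun h => hmem h.1).2
    rw [hK.row_eq_zero_of_bottom_subset hN hr hbottom] at hq ⊢
    refine ⟨q, ?_⟩
    rw [show n = N * q by simpa using hq] at hn
    push_cast at hn
    simpa using mul_left_cancel₀ (by positivity) hn
  · push Not at hbottom
    obtain ⟨u, hu, hmem⟩ := hbottom
    obtain ⟨q, hq⟩ := dvd_sub_row hN hr fun i =>
      ((hcases i u hu).resolve_left fun h => hmem h.1).2
    have hrN := hK.row_add_one_eq_of_top_subset hN hr htop
    have hrN' : ((r : ℕ) : ℝ) = N - 1 := by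
      rw [eq_sub_iff_add_eq]
      exact_mod_cast hrN
    refine ⟨q, ?_⟩
    rw [hrN', div_self (by linarith)]
    rw [show n = N * (q + 1) by rw [mul_add]; omega] at hn
    push_cast at hn
    exact mul_left_cancel₀ (by positivity) hn
  · push Not at hbottom htop
    obtain ⟨u, hu, hmem⟩ := hbottom
    obtain ⟨v, hv, hmem'⟩ := htop
    have hdvd := dvd_sub_row hN hr fun i => ((hcases i u hu).resolve_left fun h => hmem h.1).2
    have hdvd' := dvd_sub_row hN hr fun i => ((hcases i v hv).resolve_right fun h => hmem' h.1).2
    have := Int.eq_zero_of_abs_lt_dvd (dvd_sub hdvd' hdvd) (by rw [abs_lt]; omega)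
    omega

theorem mul_sub_row_mem_Ioo (hK : IsFractalSquare N D K) (hN : 2 ≤ N)
    (hr : ∀ j, (∀ i, (i, j) ∈ D) → j = r) {t : ℝ} (ht : IsStackCrossing K 0 t)
    (ht01 : t ∈ Ioo (0 : ℝ) 1) (hint : ∀ n : ℤ, N * t ≠ n) :
    N * t - (r : ℕ) ∈ Ioo (0 : ℝ) 1 := by
  have hN' : (2 : ℝ) ≤ N := by exact_mod_cast hN
  have hfloor := Int.floor_add_fract (N * t)
  have hfract : Int.fract (N * t) ∈ Ioo (0 : ℝ) 1 :=
    ⟨lt_of_le_of_ne (Int.fract_nonneg _) fun h => hint ⌊N * t⌋ (by linarith),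
      Int.fract_lt_one _⟩
  have hdvd : (N : ℤ) ∣ ⌊N * t⌋ - (r : ℕ) := dvd_sub_row hN hr fun i => by
    obtain ⟨m, hm, b, hb, hdvd⟩ := hK.exists_digit_of_isStackCrossing hN ht i (u := 1 / 2)
      ⟨by norm_num, by norm_num⟩
    have hmfloor : m = ⌊N * t⌋ := eq_of_mem_Icc_of_add_intCast_eq hfract
      (hK.coordinate_mem_Icc hN hm 1) (by simp)
    exact ⟨b, hb, by simpa [hmfloor] using hdvd⟩
  have h0 : 0 ≤ ⌊N * t⌋ := Int.floor_nonneg.2 (by nlinarith [ht01.1])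
  have h1 : ⌊N * t⌋ < N := Int.floor_lt.2 (by push_cast; nlinarith [ht01.2])
  have hrow := Int.eq_zero_of_abs_lt_dvd hdvd (by rw [abs_lt]; omega)
  have hrow' : (⌊N * t⌋ : ℝ) = (r : ℕ) := by exact_mod_cast sub_eq_zero.1 hrow
  rwa [← hrow', sub_eq_iff_eq_add'.2 hfloor.symm]

theorem eq_of_isStackCrossing_zero_of_mem_Ioo (hK : IsFractalSquare N D K) (hN : 2 ≤ N)
    (hr : ∀ j, (∀ i, (i, j) ∈ D) → j = r) {t : ℝ} (ht : IsStackCrossing K 0 t)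
    (ht01 : t ∈ Ioo (0 : ℝ) 1) : t = (r : ℕ) / (N - 1 : ℝ) := by
  have hN' : (2 : ℝ) ≤ N := by exact_mod_cast hN
  have hN1 : (0 : ℝ) < N - 1 := by linarith
  have hρ := row_height_mem_Icc hN r
  have hfix : (N : ℝ) * ((r : ℕ) / (N - 1)) - (r : ℕ) = (r : ℕ) / (N - 1) := by
    field_simp
    ring
  set ρ : ℝ := (r : ℕ) / (N - 1)
  -- The expanding map `t ↦ N t - r` keeps the crossings other than its fixed point `ρ` in the
  -- unit interval.
  have hbound : ∀ n : ℕ, ∀ t ∈ Ioo (0 : ℝ) 1, IsStackCrossing K 0 t → t ≠ ρ →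
      (N : ℝ) ^ n * |t - ρ| ≤ 1 := fun n => by
    induction n with
    | zero =>
      intro t ht01 _ _
      rw [pow_zero, one_mul, abs_le]
      constructor <;> linarith [ht01.1, ht01.2, hρ.1, hρ.2]
    | succ n ih =>
      intro t ht01 ht hne
      have hint : ∀ m : ℤ, N * t ≠ m := fun m hm => by
        obtain ⟨j, hj⟩ := hK.exists_eq_add_of_mul_eq_intCast hN hr ht hm
        have hj0 := eq_of_mem_Icc_of_add_intCast_eq (a := 0) ht01 hρ
          (by rw [add_comm, ← hj, Int.cast_zero, add_zero])
        exact hne (by rw [hj, hj0, Int.cast_zero, zero_add])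
      have hsub : N * t - (r : ℕ) - ρ = N * (t - ρ) := by linarith
      have hnext := ih _ (hK.mul_sub_row_mem_Ioo hN hr ht ht01 hint)
        (by simpa using (hK.isStackCrossing_natCast_mul hN ht).sub_intCast (r : ℕ))
        (sub_ne_zero.1 (hsub ▸ mul_ne_zero (by positivity) (sub_ne_zero.2 hne)))
      rwa [hsub, abs_mul, abs_of_pos (by positivity : (0 : ℝ) < N), ← mul_assoc,
        ← pow_succ] at hnext
  by_contra hne
  obtain ⟨n, hn⟩ := pow_unbounded_of_one_lt (1 / |t - ρ|) (by linarith : (1 : ℝ) < N)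
  rw [div_lt_iff₀ (abs_pos.2 (sub_ne_zero.2 hne))] at hn
  exact hn.not_ge (hbound n t ht01 ht hne)

theorem exists_eq_add_of_isStackCrossing_zero (hK : IsFractalSquare N D K) (hN : 2 ≤ N)
    (hr : ∀ j, (∀ i, (i, j) ∈ D) → j = r) {t : ℝ} (ht : IsStackCrossing K 0 t) :
    ∃ j : ℤ, t = j + (r : ℕ) / (N - 1 : ℝ) := by
  have hfloor := Int.floor_add_fract t
  rcases (Int.fract_nonneg t).eq_or_lt with h0 | hpos
  · rw [← h0, add_zero] at hfloor
    exact hK.exists_eq_add_of_mul_eq_intCast hN hr ht (n := N * ⌊t⌋) (by simp [hfloor])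
  · exact ⟨⌊t⌋, by rw [← hK.eq_of_isStackCrossing_zero_of_mem_Ioo hN hr (ht.sub_intCast ⌊t⌋)
      ⟨hpos, Int.fract_lt_one t⟩]; ring⟩

end IsFractalSquare

end Rows

end StackCrossings

section Arcs

theorem exists_injective_range_eq_of_injOn {X : Type*} [TopologicalSpace X] {S : Set X}
    (hS : IsCompact S) (hconn : IsPreconnected S) (hnt : S.Nontrivial) {f : X → ℝ}
    (hf : ContinuousOn f S) (hinj : InjOn f S) :
    ∃ γ : unitInterval → X, Continuous γ ∧ Function.Injective γ ∧ range γ = S := by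
  have : CompactSpace S := isCompact_iff_compactSpace.1 hS
  have himage : f '' S = Icc (sInf (f '' S)) (sSup (f '' S)) :=
    eq_Icc_of_connected_compact ⟨hnt.nonempty.image f, hconn.image f hf⟩
      (hS.image_of_continuousOn hf)
  have hlt : sInf (f '' S) < sSup (f '' S) := not_le.1 fun hle =>
    (hnt.image_of_injOn hinj).not_subsingleton (himage ▸ subsingleton_Icc_of_ge hle)
  have hcont : Continuous (Equiv.Set.imageOfInjOn f S hinj) :=
    hf.domRestrict.subtype_mk fun x => mem_image_of_mem f x.2
  let e : S ≃ₜ unitInterval := hcont.homeoOfEquivCompactToT2.trans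
    ((Homeomorph.setCongr himage).trans (iccHomeoI _ _ hlt))
  refine ⟨fun t => e.symm t, continuous_subtype_val.comp e.symm.continuous,
    Subtype.val_injective.comp e.symm.injective, ?_⟩
  change range (Subtype.val ∘ e.symm) = S
  rw [e.symm.surjective.range_comp, Subtype.range_coe]

theorem HasNullComponents.exists_two_connectedComponent_subset_ball {X : Type*} [MetricSpace X]
    [CompactSpace X] (hX : HasNullComponents X) {x : X} {ε : ℝ} (hε : 0 < ε) {P : ℕ → X}
    (hP : ∀ m, P m ∈ ball x (ε / 2)) (hinj : Function.Injective fun m => connectedComponent (P m)) :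
    ∃ m n, connectedComponent (P m) ≠ connectedComponent (P n) ∧
      connectedComponent (P m) ⊆ ball x ε ∧ connectedComponent (P n) ⊆ ball x ε := by
  have hlarge : {m | ε / 2 ≤ diam (connectedComponent (P m))}.Finite :=
    ((hX (ε / 2) (by positivity)).preimage hinj.injOn).subset fun m hm => ⟨mem_range_self _, hm⟩
  have hsmall : ∀ m ∉ {m | ε / 2 ≤ diam (connectedComponent (P m))},
      connectedComponent (P m) ⊆ ball x ε := fun m hm y hy => by
    have hy' := dist_le_diam_of_mem isBounded_of_compactSpace hy (mem_connectedComponent (x := P m))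
    have hPm := mem_ball.1 (hP m)
    have hm' : diam (connectedComponent (P m)) < ε / 2 := not_le.1 hm
    rw [mem_ball]
    linarith [dist_triangle y (P m) x]
  obtain ⟨m, hm, n, hn, hmn⟩ := hlarge.infinite_compl.nontrivial
  exact ⟨m, n, hinj.ne hmn, hsmall m hm, hsmall n hn⟩

end Arcs

section Horizontal

variable {N : ℕ} {D : Finset (Fin N × Fin N)} {K : Set Plane} {r : Fin N}

theorem IsComponentwiseConstant.eq_of_isPreconnected {φ : ℤ × ℤ}
    (hφ : IsComponentwiseConstant K φ) {S : Set K} (hS : IsPreconnected S) {x y : K} (hx : x ∈ S)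
    (hy : y ∈ S) : φ.1 * x.1 0 + φ.2 * x.1 1 = φ.1 * y.1 0 + φ.2 * y.1 1 :=
  hφ (Subtype.val '' S) (Subtype.coe_image_subset K S)
    (hS.image _ continuous_subtype_val.continuousOn) _ (mem_image_of_mem _ hx) _
    (mem_image_of_mem _ hy)

theorem IsComponentwiseConstant.snd_eq (hφ : IsComponentwiseConstant K (0, 1)) {S : Set K}
    (hS : IsPreconnected S) {x y : K} (hx : x ∈ S) (hy : y ∈ S) : x.1 1 = y.1 1 := by
  simpa using hφ.eq_of_isPreconnected hS hx hy

theorem dist_eq_abs_of_snd_eq {x y : Plane} (h : x 1 = y 1) : dist x y = |x 0 - y 0| := by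
  rw [EuclideanSpace.dist_eq, Fin.sum_univ_two, h, dist_self, Real.dist_eq]
  simp [Real.sqrt_sq_eq_abs]

theorem isCopyComponent_unitInterval_of_nontrivial [CompactSpace K]
    (hφ : IsComponentwiseConstant K (0, 1)) {x : K} (hx : (connectedComponent x).Nontrivial) :
    IsCopyComponent unitInterval (connectedComponent x) :=
  ⟨mem_range_self x, exists_injective_range_eq_of_injOn isClosed_connectedComponent.isCompact
    isPreconnected_connectedComponent hx
    ((continuous_coordinate 0).comp continuous_subtype_val).continuousOn
    fun _ hy _ hz h => Subtype.ext
      (plane_ext h (hφ.snd_eq isPreconnected_connectedComponent hy hz))⟩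

/-- The midpoints of the places where a full row can cross a column of cells of generation `k`. -/
def crossingPoints (r : Fin N) (k : ℕ) : Set Plane :=
  image2 (fun a j : ℤ => planePoint ((a + 1 / 2) / N ^ k) ((j + (r : ℕ) / (N - 1 : ℝ)) / N ^ k))
    (Icc (-1) (N ^ k)) (Icc (-1) (N ^ k))

theorem finite_crossingPoints (r : Fin N) (k : ℕ) : (crossingPoints r k).Finite :=
  (finite_Icc _ _).image2 _ (finite_Icc _ _)

theorem mem_Icc_of_add_div_mem_Icc {a n : ℤ} {θ : ℝ} (hn : 0 < n) (hθ : θ ∈ Icc (0 : ℝ) 1)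
    (h : (a + θ) / n ∈ Icc (0 : ℝ) 1) : a ∈ Icc (-1) n := by
  have hn' : (0 : ℝ) < n := by exact_mod_cast hn
  obtain ⟨h0, h1⟩ := h
  rw [le_div_iff₀ hn', zero_mul] at h0
  rw [div_le_one hn'] at h1
  have h0' : (-1 : ℝ) ≤ a := by linarith [hθ.2]
  have h1' : (a : ℝ) ≤ n := by linarith [hθ.1]
  exact ⟨by exact_mod_cast h0', by exact_mod_cast h1'⟩

namespace IsFractalSquare

theorem exists_mem_crossingPoints (hK : IsFractalSquare N D K) (hN : 2 ≤ N)
    (hr : ∀ j, (∀ i, (i, j) ∈ D) → j = r) {C : Set Plane} (hC : IsPreconnected C) (hCK : C ⊆ K)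
    {h : ℝ} (hh : ∀ z ∈ C, z 1 = h) {k : ℕ} {x y : Plane} (hx : x ∈ C) (hy : y ∈ C)
    (hxy : x 0 + 2 / N ^ k < y 0) : ∃ z ∈ C, z ∈ crossingPoints r k := by
  have hpos : (0 : ℤ) < N ^ k := by positivity
  obtain ⟨a, hline, hcross⟩ := hK.exists_isStackCrossing hN hC hCK (σ := 0)
    (h := h) (fun z hz => by simp [hh z hz]) hx hy hxy
  obtain ⟨j, hj⟩ := hK.exists_eq_add_of_isStackCrossing_zero hN hr hcross
  have hmem := hline (1 / 2) ⟨by norm_num, by norm_num⟩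
  have hheight : h = (j + (r : ℕ) / (N - 1 : ℝ)) / N ^ k := by
    rw [← hj, Int.cast_zero, zero_mul, add_zero, mul_div_cancel_left₀ h (by positivity)]
  rw [Int.cast_zero, zero_mul, zero_add, hheight] at hmem
  refine ⟨_, hmem, a, mem_Icc_of_add_div_mem_Icc hpos (θ := 1 / 2) ⟨by norm_num, by norm_num⟩ ?_,
    j, mem_Icc_of_add_div_mem_Icc hpos (row_height_mem_Icc hN r) ?_, rfl⟩
  · simpa using hK.coordinate_mem_Icc hN (hCK hmem) 0
  · simpa using hK.coordinate_mem_Icc hN (hCK hmem) 1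

theorem hasNullComponents (hK : IsFractalSquare N D K) (hN : 2 ≤ N)
    (hr : ∀ j, (∀ i, (i, j) ∈ D) → j = r) (hφ : IsComponentwiseConstant K (0, 1)) :
    HasNullComponents K := by
  have hN' : (1 : ℝ) < N := by exact_mod_cast hN
  intro ε hε
  obtain ⟨k, hk⟩ := pow_unbounded_of_one_lt (2 / ε) hN'
  rw [div_lt_comm₀ hε (by positivity)] at hk
  refine (((finite_crossingPoints r k).preimage Subtype.val_injective.injOn).image
    connectedComponent).subset ?_
  rintro _ ⟨⟨x, rfl⟩, hx⟩
  have hsnd : ∀ y ∈ connectedComponent x, ∀ z ∈ connectedComponent x, y.1 1 = z.1 1 :=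
    fun y hy z hz => hφ.snd_eq isPreconnected_connectedComponent hy hz
  have hgap : ∃ y ∈ connectedComponent x, ∃ z ∈ connectedComponent x,
      y.1 0 + 2 / N ^ k < z.1 0 := by
    by_contra! hcon
    refine (hk.trans_le hx).not_ge (diam_le_of_forall_dist_le (by positivity) fun y hy z hz => ?_)
    rw [Subtype.dist_eq, dist_eq_abs_of_snd_eq (hsnd y hy z hz), abs_le]
    constructor <;> linarith [hcon y hy z hz, hcon z hz y hy]
  obtain ⟨y, hy, z, hz, hyz⟩ := hgap
  obtain ⟨_, ⟨c, hc, rfl⟩, hcross⟩ := hK.exists_mem_crossingPoints hN hr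
    (isPreconnected_connectedComponent.image _ continuous_subtype_val.continuousOn)
    (Subtype.coe_image_subset K _) (h := y.1 1)
    (by rintro _ ⟨w, hw, rfl⟩; exact hsnd w hw y hy) (mem_image_of_mem _ hy)
    (mem_image_of_mem _ hz) hyz
  exact ⟨c, hcross, (connectedComponent_eq hc).symm⟩

theorem planePoint_mem_of_row (hK : IsFractalSquare N D K) (hN : 2 ≤ N)
    (hrow : ∀ i, (i, r) ∈ D) {u : ℝ} (hu : u ∈ Icc (0 : ℝ) 1) :
    planePoint u ((r : ℕ) / (N - 1)) ∈ K := by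
  have hN' : (2 : ℝ) ≤ N := by exact_mod_cast hN
  have hN1 : (N - 1 : ℝ) ≠ 0 := by linarith
  refine hK.subset_of_subset_biUnion_digitMap hN
    (A := (fun u : ℝ => planePoint u ((r : ℕ) / (N - 1))) '' Icc 0 1)
    (isCompact_Icc.image (continuous_planePoint continuous_id continuous_const)) ?_
    (mem_image_of_mem _ hu)
  rintro _ ⟨u, hu, rfl⟩
  obtain ⟨i, hi⟩ : ∃ i : Fin N, N * u - (i : ℕ) ∈ Icc (0 : ℝ) 1 := by
    rcases hu.2.eq_or_lt with rfl | hu1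
    · exact ⟨⟨N - 1, by omega⟩, by simp [Nat.cast_sub (by omega : 1 ≤ N)]⟩
    · have hu0 : 0 ≤ N * u := mul_nonneg N.cast_nonneg hu.1
      have hfloor := Nat.lt_floor_add_one (N * u)
      exact ⟨⟨⌊N * u⌋₊, (Nat.floor_lt hu0).2 (by nlinarith)⟩,
        sub_nonneg.2 (Nat.floor_le hu0), by simp only; linarith⟩
  refine mem_biUnion (hrow i) ⟨_, mem_image_of_mem _ hi, plane_ext ?_ ?_⟩
  · simp only [digitMap_zero, planePoint_zero]
    field_simp
    ring
  · simp only [digitMap_one, planePoint_one]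
    field_simp
    ring

theorem connectedComponent_cellMap_nontrivial (hK : IsFractalSquare N D K) (hN : 2 ≤ N)
    (hrow : ∀ i, (i, r) ∈ D) {n : ℕ} {w : List (Fin N × Fin N)} (hw : w ∈ words D n) {x : K}
    (hx : x.1 = cellMap w (planePoint 0 ((r : ℕ) / (N - 1)))) :
    (connectedComponent x).Nontrivial := by
  let γ : unitInterval → K := fun u => ⟨cellMap w (planePoint u ((r : ℕ) / (N - 1))),
    hK.cellMap_mem hw (hK.planePoint_mem_of_row hN hrow u.2)⟩
  have hγ : Continuous γ := ((continuous_cellMap w).comp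
    (continuous_planePoint continuous_subtype_val continuous_const)).subtype_mk _
  have hx0 : γ 0 = x := Subtype.ext hx.symm
  refine ⟨x, mem_connectedComponent, γ 1, ?_, fun h => ?_⟩
  · exact (isPreconnected_range hγ).subset_connectedComponent ⟨0, hx0⟩ (mem_range_self 1)
  · have := cellMap_injective w (congrArg Subtype.val (hx0.trans h))
    simpa using congrArg (fun z : Plane => z 0) this

end IsFractalSquare

theorem cellMap_replicate_one (hN : 2 ≤ N) (d : Fin N × Fin N) (m : ℕ) (x : Plane) :
    cellMap (List.replicate m d) x 1 =
      (d.2 : ℕ) / (N - 1 : ℝ) + (x 1 - (d.2 : ℕ) / (N - 1)) / N ^ m := by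
  have hN' : (2 : ℝ) ≤ N := by exact_mod_cast hN
  have hN1 : (N - 1 : ℝ) ≠ 0 := by linarith
  induction m generalizing x with
  | zero => simp [cellMap]
  | succ m ih =>
    rw [List.replicate_succ, cellMap, Function.comp_apply, ih, digitMap_one]
    field_simp
    ring

theorem snd_eq_of_cellMap_snd_eq {w : List (Fin N × Fin N)} {x y : Plane}
    (h : cellMap w x 1 = cellMap w y 1) : x 1 = y 1 := by
  have hx := (cellMap_coordinates w x).2
  rw [h, (cellMap_coordinates w y).2] at hx
  linarith

theorem cellMap_replicate_append_snd_injective (hN : 2 ≤ N) {d : Fin N × Fin N} (hd : d.2 ≠ r)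
    (w : List (Fin N × Fin N)) : Function.Injective fun m =>
      cellMap (List.replicate m d ++ w) (planePoint 0 ((r : ℕ) / (N - 1 : ℝ))) 1 := by
  have hN' : (2 : ℝ) ≤ N := by exact_mod_cast hN
  have hN1 : (N - 1 : ℝ) ≠ 0 := by linarith
  intro m n hmn
  simp only [cellMap_append] at hmn
  have h := snd_eq_of_cellMap_snd_eq hmn
  have hne : (r : ℕ) / (N - 1 : ℝ) - (d.2 : ℕ) / (N - 1) ≠ 0 := by
    rw [sub_ne_zero, Ne, div_left_inj' hN1, Nat.cast_inj, ← Fin.ext_iff]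
    exact hd.symm
  rw [cellMap_replicate_one hN, cellMap_replicate_one hN, planePoint_one, add_right_inj,
    div_eq_div_iff (by positivity) (by positivity), mul_right_inj' hne] at h
  exact pow_right_injective₀ (by linarith) (by linarith) h.symm

namespace IsFractalSquare

theorem exists_two_isCopyComponent_subset (hK : IsFractalSquare N D K) (hN : 2 ≤ N)
    (hrow : ∀ i, (i, r) ∈ D) (hr : ∀ j, (∀ i, (i, j) ∈ D) → j = r) {d : Fin N × Fin N}
    (hd : d ∈ D) (hdr : d.2 ≠ r) (hφ : IsComponentwiseConstant K (0, 1)) {U : Set K}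
    (hU : IsOpen U) (hne : U.Nonempty) :
    ∃ S T, S ≠ T ∧ IsCopyComponent unitInterval S ∧ IsCopyComponent unitInterval T ∧
      S ⊆ U ∧ T ⊆ U := by
  have := hK.compactSpace
  obtain ⟨x, hx⟩ := hne
  obtain ⟨ε, hε, hεU⟩ := Metric.isOpen_iff.1 hU x hx
  obtain ⟨n, w, hw, hcell⟩ := hK.exists_cell_subset_ball hN x.2 (half_pos hε)
  have hs := hK.planePoint_mem_of_row hN hrow (u := 0) ⟨le_rfl, zero_le_one⟩
  have hrep : ∀ m, List.replicate m d ∈ words D m := fun m =>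
    ⟨List.length_replicate, fun e he => List.eq_of_mem_replicate he ▸ hd⟩
  have hword : ∀ m, List.replicate m d ++ w ∈ words D (m + n) := fun m =>
    append_mem_words (hrep m) hw
  let P : ℕ → K := fun m => ⟨cellMap (List.replicate m d ++ w) _, hK.cellMap_mem (hword m) hs⟩
  have hball : ∀ m, P m ∈ ball x (ε / 2) := fun m =>
    hcell ⟨_, hK.cellMap_mem (hrep m) hs, (cellMap_append _ _ _).symm⟩
  have hinj : Function.Injective fun m => connectedComponent (P m) := by
    intro m k (hmk : connectedComponent (P m) = connectedComponent (P k))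
    exact cellMap_replicate_append_snd_injective hN hdr w
      (hφ.snd_eq isPreconnected_connectedComponent mem_connectedComponent
        (hmk ▸ mem_connectedComponent : P k ∈ connectedComponent (P m)))
  have hcopy : ∀ m, IsCopyComponent unitInterval (connectedComponent (P m)) := fun m =>
    isCopyComponent_unitInterval_of_nontrivial hφ
      (hK.connectedComponent_cellMap_nontrivial hN hrow (hword m) rfl)
  obtain ⟨m, k, hmk, hm, hk⟩ :=
    (hK.hasNullComponents hN hr hφ).exists_two_connectedComponent_subset_ball hε hball hinj
  exact ⟨_, _, hmk, hcopy m, hcopy k, hm.trans hεU, hk.trans hεU⟩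

theorem isDecorated_unitInterval (hK : IsFractalSquare N D K) (hN : 2 ≤ N)
    (hrow : ∀ i, (i, r) ∈ D) (hr : ∀ j, (∀ i, (i, j) ∈ D) → j = r) {d : Fin N × Fin N}
    (hd : d ∈ D) (hdr : d.2 ≠ r) (hφ : IsComponentwiseConstant K (0, 1)) :
    IsDecorated unitInterval K where
  component x := (connectedComponent x).subsingleton_or_nontrivial.imp_right fun hx =>
    have := hK.compactSpace
    isCopyComponent_unitInterval_of_nontrivial hφ hx
  null := hK.hasNullComponents hN hr hφ
  dense _ hU hne := hK.exists_two_isCopyComponent_subset hN hrow hr hd hdr hφ hU hne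

end IsFractalSquare

end Horizontal

section TotallyDisconnected

variable {N : ℕ} {D : Finset (Fin N × Fin N)} {K : Set Plane}

theorem totallyDisconnectedSpace_of_isComponentwiseConstant {φ ψ : ℤ × ℤ}
    (hφ : IsComponentwiseConstant K φ) (hψ : IsComponentwiseConstant K ψ)
    (hdet : φ.1 * ψ.2 - φ.2 * ψ.1 ≠ 0) : TotallyDisconnectedSpace K := by
  refine ⟨fun S _ hS x hx y hy => Subtype.ext ?_⟩
  have h1 := hφ.eq_of_isPreconnected hS hx hy
  have h2 := hψ.eq_of_isPreconnected hS hx hy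
  have hdet' : (φ.1 * ψ.2 - φ.2 * ψ.1 : ℝ) ≠ 0 := by exact_mod_cast hdet
  refine plane_ext (mul_left_cancel₀ hdet' ?_) (mul_left_cancel₀ hdet' ?_)
  · linear_combination (ψ.2 : ℝ) * h1 - φ.2 * h2
  · linear_combination (φ.1 : ℝ) * h2 - ψ.1 * h1

namespace IsFractalSquare

theorem totallyDisconnectedSpace_of_not_isStackCrossing (hK : IsFractalSquare N D K) (hN : 2 ≤ N)
    {σ : ℤ} (hφ : IsComponentwiseConstant K (-σ, 1)) (hσ : ∀ t, ¬ IsStackCrossing K σ t) :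
    TotallyDisconnectedSpace K := by
  have hN' : (1 : ℝ) < N := by exact_mod_cast hN
  refine ⟨fun S _ hS => ?_⟩
  have hline : ∀ x ∈ S, ∀ y ∈ S, x.1 1 = σ * x.1 0 + (y.1 1 - σ * y.1 0) := fun x hx y hy => by
    have := hφ.eq_of_isPreconnected hS hx hy
    push_cast at this
    linarith
  have hle : ∀ x ∈ S, ∀ y ∈ S, y.1 0 ≤ x.1 0 := fun x hx y hy => by
    by_contra! hxy
    obtain ⟨k, hk⟩ := pow_unbounded_of_one_lt (2 / (y.1 0 - x.1 0)) hN'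
    rw [div_lt_comm₀ (sub_pos.2 hxy) (by positivity), lt_sub_iff_add_lt'] at hk
    obtain ⟨a, -, ha⟩ := hK.exists_isStackCrossing hN
      (hS.image _ continuous_subtype_val.continuousOn) (Subtype.coe_image_subset K _)
      (by rintro _ ⟨z, hz, rfl⟩; exact hline z hz x hx) (mem_image_of_mem _ hx)
      (mem_image_of_mem _ hy) hk
    exact hσ _ ha
  intro x hx y hy
  have h0 := le_antisymm (hle y hy x hx) (hle x hx y hy)
  exact Subtype.ext (plane_ext h0 (by rw [hline x hx y hy, h0]; ring))

theorem isDecorated_unit (hK : IsFractalSquare N D K) (hN : 2 ≤ N) (hD : D.Nontrivial)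
    [TotallyDisconnectedSpace K] : IsDecorated Unit K := by
  have := hK.compactSpace
  refine isDecorated_unit_of_forall_nontrivial fun U hU hne => ?_
  obtain ⟨x, hx⟩ := hne
  obtain ⟨ε, hε, hεU⟩ := Metric.isOpen_iff.1 hU x hx
  obtain ⟨n, w, hw, hcell⟩ := hK.exists_cell_subset_ball hN x.2 hε
  obtain ⟨y, hy, z, hz, hyz⟩ := hK.nontrivial hN hD
  exact ⟨⟨_, hK.cellMap_mem hw hy⟩, hεU (hcell (mem_image_of_mem _ hy)),
    ⟨_, hK.cellMap_mem hw hz⟩, hεU (hcell (mem_image_of_mem _ hz)),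
    fun h => hyz (cellMap_injective w (congrArg Subtype.val h))⟩

end IsFractalSquare

end TotallyDisconnected

section Affine

/-- An affine map of the plane with integer coefficients, given by its linear part with rows
`(a, b)` and `(c, d)` and its translation part `(p, q)`. -/
structure IntegerAffineMap where
  (a b c d p q : ℤ)

/-- The integer vector with the same coordinates as a digit. -/
def digitVec {N : ℕ} (d : Fin N × Fin N) : ℤ × ℤ := ((d.1 : ℕ), (d.2 : ℕ))

theorem digitVec_injective {N : ℕ} : Function.Injective (digitVec (N := N)) := fun d e h => by
  simp only [digitVec, Prod.mk.injEq, Nat.cast_inj] at h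
  exact Prod.ext (Fin.ext h.1) (Fin.ext h.2)

namespace IntegerAffineMap

variable {N : ℕ}

/-- The determinant of the linear part. -/
def det (M : IntegerAffineMap) : ℤ := M.a * M.d - M.b * M.c

/-- The action on integer vectors. -/
def onLattice (M : IntegerAffineMap) (v : ℤ × ℤ) : ℤ × ℤ :=
  (M.a * v.1 + M.b * v.2 + M.p, M.c * v.1 + M.d * v.2 + M.q)

/-- The action on the plane. The translation part is divided by `N - 1`, so that the fixed point of
the digit map of `d` is moved in the same way as the digit `d`. -/
noncomputable def onPlane (N : ℕ) (M : IntegerAffineMap) (x : Plane) : Plane :=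
  planePoint (M.a * x 0 + M.b * x 1 + M.p / (N - 1)) (M.c * x 0 + M.d * x 1 + M.q / (N - 1))

/-- The composition of two integer affine maps, the right one being applied first. -/
def comp (T M : IntegerAffineMap) : IntegerAffineMap where
  a := T.a * M.a + T.b * M.c
  b := T.a * M.b + T.b * M.d
  c := T.c * M.a + T.d * M.c
  d := T.c * M.b + T.d * M.d
  p := T.a * M.p + T.b * M.q + T.p
  q := T.c * M.p + T.d * M.q + T.q

/-- `M` maps the digits in `D` to digits in `E`. -/
def MapsDigits (M : IntegerAffineMap) (D E : Finset (Fin N × Fin N)) : Prop :=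
  ∀ d ∈ D, ∃ e ∈ E, M.onLattice (digitVec d) = digitVec e

instance (M : IntegerAffineMap) (D E : Finset (Fin N × Fin N)) : Decidable (M.MapsDigits D E) :=
  inferInstanceAs (Decidable (∀ d ∈ D, ∃ e ∈ E, _))

variable {M : IntegerAffineMap}

theorem onLattice_injective (hM : M.det ≠ 0) : Function.Injective M.onLattice := by
  intro v w h
  simp only [onLattice, Prod.mk.injEq] at h
  simp only [det] at hM
  refine Prod.ext (mul_left_cancel₀ hM ?_) (mul_left_cancel₀ hM ?_)
  · linear_combination M.d * h.1 - M.b * h.2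
  · linear_combination M.a * h.2 - M.c * h.1

theorem det_comp (T M : IntegerAffineMap) : (T.comp M).det = T.det * M.det := by
  simp only [det, comp]
  ring

theorem onPlane_injective (hM : M.det ≠ 0) : Function.Injective (M.onPlane N) := by
  have hdet : (M.a * M.d - M.b * M.c : ℝ) ≠ 0 := by exact_mod_cast hM
  intro x y h
  have h0 := congrArg (fun z : Plane => z 0) h
  have h1 := congrArg (fun z : Plane => z 1) h
  simp only [onPlane, planePoint_zero, planePoint_one] at h0 h1
  refine plane_ext (mul_left_cancel₀ hdet ?_) (mul_left_cancel₀ hdet ?_)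
  · linear_combination (M.d : ℝ) * h0 - M.b * h1
  · linear_combination (M.a : ℝ) * h1 - M.c * h0

theorem continuous_onPlane : Continuous (M.onPlane N) :=
  continuous_planePoint (by fun_prop) (by fun_prop)

theorem onPlane_digitMap (hN : 2 ≤ N) {d e : Fin N × Fin N}
    (h : M.onLattice (digitVec d) = digitVec e) (x : Plane) :
    M.onPlane N (digitMap N d x) = digitMap N e (M.onPlane N x) := by
  have hN' : (2 : ℝ) ≤ N := by exact_mod_cast hN
  have hN1 : (N - 1 : ℝ) ≠ 0 := by linarith
  have h0 := congrArg (fun v : ℤ × ℤ => (v.1 : ℝ)) h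
  have h1 := congrArg (fun v : ℤ × ℤ => (v.2 : ℝ)) h
  simp only [onLattice, digitVec] at h0 h1
  push_cast at h0 h1
  refine plane_ext ?_ ?_
  · simp only [onPlane, planePoint_zero, digitMap_zero, digitMap_one, ← h0]
    field_simp
    ring
  · simp only [onPlane, planePoint_one, digitMap_zero, digitMap_one, ← h1]
    field_simp
    ring

theorem isFractalSquare_image (hN : 2 ≤ N) (hM : M.det ≠ 0) {D E : Finset (Fin N × Fin N)}
    (hcard : E.card = D.card) (h : M.MapsDigits D E) {K : Set Plane}
    (hK : IsFractalSquare N D K) : IsFractalSquare N E (M.onPlane N '' K) := by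
  choose! g hgE hg using h
  have hinj : InjOn g D := fun d hd e he hde =>
    digitVec_injective (onLattice_injective hM (by rw [hg d hd, hg e he, hde]))
  have himg : D.image g = E := Finset.eq_of_subset_of_card_le
    (Finset.image_subset_iff.2 hgE) (by rw [Finset.card_image_of_injOn hinj, hcard])
  refine ⟨hK.nonempty.image _, hK.isCompact.image continuous_onPlane, ?_⟩
  conv_lhs => rw [hK.eq_iUnion]
  rw [← himg, Finset.set_biUnion_finset_image, image_iUnion₂]
  refine iUnion₂_congr fun d hd => ?_
  rw [image_image, image_image]
  exact image_congr fun x _ => onPlane_digitMap hN (hg d hd) x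

theorem nonempty_homeomorph_image (hM : M.det ≠ 0) {K : Set Plane} (hK : IsCompact K) :
    Nonempty (K ≃ₜ M.onPlane N '' K) := by
  have : CompactSpace K := isCompact_iff_compactSpace.1 hK
  have hemb : IsClosedEmbedding fun x : K => M.onPlane N x :=
    (continuous_onPlane.comp continuous_subtype_val).isClosedEmbedding
      ((onPlane_injective hM).comp Subtype.val_injective)
  exact ⟨hemb.isEmbedding.toHomeomorph.trans (Homeomorph.setCongr (image_eq_range _ _).symm)⟩

theorem nonempty_homeomorph_fractalSquare (hN : 2 ≤ N) (hM : M.det ≠ 0)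
    {D E : Finset (Fin N × Fin N)} (hD : D.Nonempty) (hcard : E.card = D.card)
    (h : M.MapsDigits D E) : Nonempty (fractalSquare N D ≃ₜ fractalSquare N E) := by
  have hK := isFractalSquare_fractalSquare N hN D hD
  have hE : E.Nonempty := Finset.card_pos.1 (hcard ▸ hD.card_pos)
  rw [(isFractalSquare_image hN hM hcard h hK).eq_fractalSquare hN hE]
  exact nonempty_homeomorph_image hM hK.isCompact

end IntegerAffineMap

end Affine

section Connected

variable {N : ℕ} {D : Finset (Fin N × Fin N)}

/-- The images under the digit maps of `d` and `e` of the fixed points of two digit maps `a` and `b`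
coincide, that is, `a + (N - 1) d = b + (N - 1) e`. Both sides are moved so that no subtraction
occurs. -/
def AdjacentDigits (D : Finset (Fin N × Fin N)) (d e : Fin N × Fin N) : Prop :=
  ∃ a ∈ D, ∃ b ∈ D, (a.1 + N * d.1 + e.1 : ℕ) = b.1 + N * e.1 + d.1 ∧
    (a.2 + N * d.2 + e.2 : ℕ) = b.2 + N * e.2 + d.2

instance (d e : Fin N × Fin N) : Decidable (AdjacentDigits D d e) :=
  inferInstanceAs (Decidable (∃ a ∈ D, ∃ b ∈ D, _))

/-- The digits `d` and `e` are joined by a chain of at most `n` steps between adjacent digits. -/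
def AreJoined (D : Finset (Fin N × Fin N)) : ℕ → Fin N × Fin N → Fin N × Fin N → Prop
  | 0, d, e => d = e
  | n + 1, d, e => d = e ∨ ∃ f ∈ D, AdjacentDigits D d f ∧ AreJoined D n f e

instance AreJoined.decidable (D : Finset (Fin N × Fin N)) :
    ∀ n d e, Decidable (AreJoined D n d e)
  | 0, d, e => inferInstanceAs (Decidable (d = e))
  | n + 1, d, e =>
    haveI := AreJoined.decidable D n
    inferInstanceAs (Decidable (d = e ∨ ∃ f ∈ D, AdjacentDigits D d f ∧ AreJoined D n f e))

/-- The graph of adjacent digits of `D` is connected. -/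
def HasConnectedDigits (D : Finset (Fin N × Fin N)) : Prop :=
  ∀ d ∈ D, ∀ e ∈ D, AreJoined D D.card d e

instance (D : Finset (Fin N × Fin N)) : Decidable (HasConnectedDigits D) :=
  inferInstanceAs (Decidable (∀ d ∈ D, ∀ e ∈ D, _))

theorem AdjacentDigits.exists_digitMap_digitFixedPoint_eq (hN : 2 ≤ N) {d e : Fin N × Fin N}
    (h : AdjacentDigits D d e) : ∃ a ∈ D, ∃ b ∈ D,
      digitMap N d (digitFixedPoint a) = digitMap N e (digitFixedPoint b) := by
  obtain ⟨a, ha, b, hb, h0, h1⟩ := h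
  have hN' : (2 : ℝ) ≤ N := by exact_mod_cast hN
  have hN1 : (N - 1 : ℝ) ≠ 0 := by linarith
  have h0' : ((a.1 : ℕ) : ℝ) + N * (d.1 : ℕ) + (e.1 : ℕ) =
      (b.1 : ℕ) + N * (e.1 : ℕ) + (d.1 : ℕ) := by
    exact_mod_cast h0
  have h1' : ((a.2 : ℕ) : ℝ) + N * (d.2 : ℕ) + (e.2 : ℕ) =
      (b.2 : ℕ) + N * (e.2 : ℕ) + (d.2 : ℕ) := by
    exact_mod_cast h1
  refine ⟨a, ha, b, hb, plane_ext ?_ ?_⟩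
  · simp only [digitMap_zero, digitFixedPoint, planePoint_zero]
    field_simp
    linarith
  · simp only [digitMap_one, digitFixedPoint, planePoint_one]
    field_simp
    linarith

namespace IsFractalSquare

variable {K : Set Plane}

theorem mapsTo_digitMap_of_areJoined (hK : IsFractalSquare N D K) (hN : 2 ≤ N) {u v : Set Plane}
    (huv : Disjoint u v) {g : Plane → Plane}
    (h : ∀ d ∈ D, MapsTo (g ∘ digitMap N d) K u ∨ MapsTo (g ∘ digitMap N d) K v) {n : ℕ}
    {d e : Fin N × Fin N} (hde : AreJoined D n d e) (hd : MapsTo (g ∘ digitMap N d) K u) :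
    MapsTo (g ∘ digitMap N e) K u := by
  induction n generalizing d with
  | zero => rwa [← hde]
  | succ n ih =>
    rcases hde with rfl | ⟨f, hf, hdf, hfe⟩
    · exact hd
    obtain ⟨a, ha, b, hb, hab⟩ := hdf.exists_digitMap_digitFixedPoint_eq hN
    refine ih hfe ((h f hf).resolve_right fun hfv => ?_)
    have hau := hd (hK.digitFixedPoint_mem hN ha)
    rw [Function.comp_apply, hab] at hau
    exact disjoint_left.1 huv hau (hfv (hK.digitFixedPoint_mem hN hb))

theorem mapsTo_or_mapsTo_of_forall_digitMap (hK : IsFractalSquare N D K) (hN : 2 ≤ N)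
    (hD : HasConnectedDigits D) {u v : Set Plane} (huv : Disjoint u v) {g : Plane → Plane}
    (h : ∀ d ∈ D, MapsTo (g ∘ digitMap N d) K u ∨ MapsTo (g ∘ digitMap N d) K v) :
    MapsTo g K u ∨ MapsTo g K v := by
  have hmaps : ∀ t : Set Plane, (∀ d ∈ D, MapsTo (g ∘ digitMap N d) K t) → MapsTo g K t :=
    fun t ht x hx => by
      obtain ⟨d, hd, y, hy, rfl⟩ := hK.exists_digitMap_eq hx
      exact ht d hd hy
  by_cases hu : ∃ d ∈ D, MapsTo (g ∘ digitMap N d) K u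
  · obtain ⟨d, hd, hdu⟩ := hu
    exact .inl (hmaps u fun e he => hK.mapsTo_digitMap_of_areJoined hN huv h (hD d hd e he) hdu)
  · exact .inr (hmaps v fun d hd => (h d hd).resolve_left fun hdu => hu ⟨d, hd, hdu⟩)

theorem exists_forall_mapsTo_or_mapsTo (hK : IsFractalSquare N D K) (hN : 2 ≤ N) {u v : Set Plane}
    (hu : IsClosed u) (hv : IsClosed v) (hcover : K ⊆ u ∪ v) (huv : Disjoint u v) :
    ∃ n, ∀ w ∈ words D n, MapsTo (cellMap w) K u ∨ MapsTo (cellMap w) K v := by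
  have hopen : K ⊆ ⋃₀ {uᶜ, vᶜ} := by
    rw [sUnion_pair, ← compl_inter, huv.inter_eq, compl_empty]
    exact subset_univ K
  obtain ⟨δ, hδ, hball⟩ := lebesgue_number_lemma_of_metric_sUnion hK.isCompact
    (by simpa using ⟨hu, hv⟩) hopen
  obtain ⟨n, hn⟩ := hK.exists_forall_dist_cellMap_lt hN hδ
  refine ⟨n, fun w hw => ?_⟩
  obtain ⟨x, hx⟩ := hK.nonempty
  have hcell : ∀ y ∈ K, cellMap w y ∈ ball (cellMap w x) δ := fun y hy => hn w hw y hy x hx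
  obtain ⟨t, rfl | rfl, ht⟩ := hball _ (hK.cellMap_mem hw hx)
  · exact .inr fun y hy => (hcover (hK.cellMap_mem hw hy)).resolve_left (ht (hcell y hy))
  · exact .inl fun y hy => (hcover (hK.cellMap_mem hw hy)).resolve_right (ht (hcell y hy))

theorem isPreconnected (hK : IsFractalSquare N D K) (hN : 2 ≤ N) (hD : HasConnectedDigits D) :
    IsPreconnected K := by
  refine (isPreconnected_iff_subset_of_fully_disjoint_closed hK.isCompact.isClosed).2
    fun u v hu hv hcover huv => ?_
  obtain ⟨n, hn⟩ := hK.exists_forall_mapsTo_or_mapsTo hN hu hv hcover huv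
  have hzero : ∀ w ∈ words D 0, MapsTo (cellMap w) K u ∨ MapsTo (cellMap w) K v := by
    induction n with
    | zero => exact hn
    | succ n ih =>
      exact ih fun w hw => hK.mapsTo_or_mapsTo_of_forall_digitMap hN hD huv fun d hd =>
        hn (d :: w) (cons_mem_words.2 ⟨hd, hw⟩)
  exact hzero [] ⟨rfl, List.forall_mem_nil _⟩

end IsFractalSquare

end Connected

section Certificates

variable {N : ℕ} {D E : Finset (Fin N × Fin N)}

theorem IsDecorated.nonempty_homeomorph_fractalSquare {I : Type*} [MetricSpace I]
    [CompactSpace I] [Nonempty I] (hN : 2 ≤ N) (hD : D.Nonempty) (hE : E.Nonempty)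
    (h : IsDecorated I (fractalSquare N D)) (h' : IsDecorated I (fractalSquare N E)) :
    Nonempty (fractalSquare N D ≃ₜ fractalSquare N E) := by
  have hK := isFractalSquare_fractalSquare N hN D hD
  have hL := isFractalSquare_fractalSquare N hN E hE
  have := hK.compactSpace
  have := hL.compactSpace
  have := hK.nonempty.to_subtype
  have := hL.nonempty.to_subtype
  exact h.nonempty_homeomorph h'

/-- A certificate for `fractalSquare N D` to be decorated by intervals: `r` is the only full row,
some digit lies outside of it, and the height has a labelling. -/
def IsRowCertificate (D : Finset (Fin N × Fin N)) (S : Finset (ℤ × ℤ))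
    (c : Matrix (Fin N) (Fin N) ℤ) (r : Fin N) : Prop :=
  (∀ i, (i, r) ∈ D) ∧ (∀ j, (∀ i, (i, j) ∈ D) → j = r) ∧ (∃ d ∈ D, d.2 ≠ r) ∧
    IsLabelling D S (0, 1) c

instance (S : Finset (ℤ × ℤ)) (c : Matrix (Fin N) (Fin N) ℤ) (r : Fin N) :
    Decidable (IsRowCertificate D S c r) :=
  inferInstanceAs (Decidable (_ ∧ _ ∧ _ ∧ _))

variable {S : Finset (ℤ × ℤ)} {b c : Matrix (Fin N) (Fin N) ℤ} {r : Fin N}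

theorem IsRowCertificate.isDecorated (hN : 2 ≤ N) (h : IsRowCertificate D S c r) :
    IsDecorated unitInterval (fractalSquare N D) := by
  obtain ⟨hrow, hr, ⟨d, hd, hdr⟩, hc⟩ := h
  have hK := isFractalSquare_fractalSquare N hN D ⟨d, hd⟩
  exact hK.isDecorated_unitInterval hN hrow hr hd hdr (hK.isComponentwiseConstant hN hc)

theorem totallyDisconnectedSpace_of_isLabelling (hN : 2 ≤ N) (hD : D.Nonempty)
    (hb : IsLabelling D S (1, 0) b) (hc : IsLabelling D S (0, 1) c) :
    TotallyDisconnectedSpace (fractalSquare N D) := by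
  have hK := isFractalSquare_fractalSquare N hN D hD
  exact totallyDisconnectedSpace_of_isComponentwiseConstant (hK.isComponentwiseConstant hN hb)
    (hK.isComponentwiseConstant hN hc) (by norm_num)

theorem totallyDisconnectedSpace_of_isLabelling_of_column (hN : 2 ≤ N) (hD : D.Nonempty)
    (hc : IsLabelling D S (-1, 1) c) {i j : Fin N} (hij : i ≠ j) (hi : ∀ k, (i, k) ∈ D → k = j) :
    TotallyDisconnectedSpace (fractalSquare N D) := by
  have hK := isFractalSquare_fractalSquare N hN D hD
  exact hK.totallyDisconnectedSpace_of_not_isStackCrossing hN (hK.isComponentwiseConstant hN hc)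
    (hK.not_isStackCrossing_one hN hi hij)

end Certificates

section Classification

/-- The digit sets with one full row whose cells touch only along rows. -/
def separatedRowSets : List (Finset (Fin 3 × Fin 3)) := [D4, D5,
  {(0, 0), (0, 1), (1, 0), (1, 1), (2, 0)}, {(0, 0), (0, 1), (1, 0), (2, 0), (2, 1)},
  {(0, 0), (0, 1), (1, 0), (1, 1), (2, 1)}, {(0, 0), (0, 1), (1, 1), (1, 2), (2, 1)},
  {(0, 0), (0, 1), (1, 1), (2, 0), (2, 1)}]

/-- The representatives of the digit sets whose fractal squares have as components points and
horizontal segments. -/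
def rowSets : List (Finset (Fin 3 × Fin 3)) :=
  separatedRowSets ++ [{(0, 0), (0, 1), (1, 0), (1, 2), (2, 0)}, D7]

/-- The representatives of the digit sets whose fractal squares are Cantor sets. -/
def cantorSets : List (Finset (Fin 3 × Fin 3)) := [
  {(0, 0), (0, 1), (1, 2), (2, 0), (2, 1)}, {(0, 0), (0, 1), (1, 1), (1, 2), (2, 0)},
  {(0, 0), (0, 1), (1, 0), (1, 2), (2, 1)}, {(0, 0), (0, 1), (1, 0), (1, 2), (2, 2)},
  {(0, 0), (0, 1), (1, 2), (2, 0), (2, 2)}]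

/-- The representatives of the digit sets with connected fractal squares. -/
def connectedSets : List (Finset (Fin 3 × Fin 3)) := [
  {(0, 0), (0, 1), (0, 2), (1, 0), (2, 0)}, {(0, 0), (0, 1), (0, 2), (1, 1), (2, 0)},
  {(0, 0), (0, 1), (0, 2), (1, 1), (2, 1)}, {(0, 0), (0, 2), (1, 1), (2, 0), (2, 2)},
  {(0, 1), (1, 0), (1, 1), (1, 2), (2, 1)}]

/-- The representatives of the digit sets with five elements up to integer affine maps. -/
def affineRepresentatives : List (Finset (Fin 3 × Fin 3)) :=
  rowSets ++ cantorSets ++ connectedSets ++ [D6]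

/-- The representatives of the topological classes. -/
def topologicalRepresentatives : List (Finset (Fin 3 × Fin 3)) :=
  connectedSets ++ [{(0, 0), (0, 1), (1, 2), (2, 0), (2, 1)}, D4, D6]

/-- The symmetries of the square `{0, 1, 2}²`. -/
def squareSymmetries : List IntegerAffineMap := [
  ⟨1, 0, 0, 1, 0, 0⟩, ⟨-1, 0, 0, 1, 2, 0⟩, ⟨1, 0, 0, -1, 0, 2⟩, ⟨-1, 0, 0, -1, 2, 2⟩,
  ⟨0, 1, 1, 0, 0, 0⟩, ⟨0, -1, 1, 0, 2, 0⟩, ⟨0, 1, -1, 0, 0, 2⟩, ⟨0, -1, -1, 0, 2, 2⟩]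

/-- Affine maps which, composed with symmetries of the square, relate all affinely equivalent
digit sets with five elements. -/
def shears : List IntegerAffineMap := [
  ⟨1, 0, 0, 1, 0, 0⟩, ⟨0, 1, -1, 1, 0, 1⟩, ⟨0, -1, 1, -1, 2, 1⟩, ⟨-1, 1, 0, -1, 1, 2⟩]

theorem exists_mapsDigits_affineRepresentative :
    ∀ D ∈ Finset.powersetCard 5 (Finset.univ : Finset (Fin 3 × Fin 3)),
      ∃ T ∈ shears, ∃ E ∈ affineRepresentatives, ∃ M ∈ squareSymmetries,
        (T.comp M).MapsDigits D E := by
  decide +kernel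

theorem card_affineRepresentatives : ∀ E ∈ affineRepresentatives, E.card = 5 := by decide +kernel

theorem exists_homeomorph_affineRepresentative {D : Finset (Fin 3 × Fin 3)} (hD : D.card = 5) :
    ∃ E ∈ affineRepresentatives, Nonempty (fractalSquare 3 D ≃ₜ fractalSquare 3 E) := by
  have hshear : ∀ T ∈ shears, T.det ≠ 0 := by decide
  have hsymm : ∀ M ∈ squareSymmetries, M.det ≠ 0 := by decide
  obtain ⟨T, hT, E, hE, M, hM, hDE⟩ := exists_mapsDigits_affineRepresentative D
    (Finset.mem_powersetCard.2 ⟨Finset.subset_univ D, hD⟩)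
  refine ⟨E, hE, IntegerAffineMap.nonempty_homeomorph_fractalSquare (by norm_num) ?_
    (Finset.card_pos.1 (by omega)) ((card_affineRepresentatives E hE).trans hD.symm) hDE⟩
  rw [IntegerAffineMap.det_comp]
  exact mul_ne_zero (hshear T hT) (hsymm M hM)

theorem isDecorated_of_mem_rowSets {D : Finset (Fin 3 × Fin 3)} (hD : D ∈ rowSets) :
    IsDecorated unitInterval (fractalSquare 3 D) := by
  have hseparated : ∀ E ∈ separatedRowSets,
      ∃ r, IsRowCertificate E {(-1, 0), (0, 0), (1, 0)} 0 r := by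
    decide +kernel
  simp only [rowSets, List.mem_append, List.mem_cons, List.not_mem_nil, or_false] at hD
  rcases hD with hD | rfl | rfl
  · obtain ⟨r, hr⟩ := hseparated D hD
    exact hr.isDecorated (by norm_num)
  · exact IsRowCertificate.isDecorated (S := {(-1, 0), (0, -1), (0, 0), (0, 1), (1, 0)})
      (c := !![0, -1, 0; 0, 0, 1; 0, 0, 0]) (r := 0) (by norm_num) (by decide +kernel)
  · exact IsRowCertificate.isDecorated
      (S := {(-1, 0), (-1, 1), (0, -1), (0, 0), (0, 1), (1, -1), (1, 0)})
      (c := !![0, 0, 1; 0, 0, 0; 0, -1, 0]) (r := 0) (by norm_num) (by decide +kernel)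

theorem totallyDisconnectedSpace_of_mem_cantorSets {D : Finset (Fin 3 × Fin 3)}
    (hD : D ∈ cantorSets) : TotallyDisconnectedSpace (fractalSquare 3 D) := by
  simp only [cantorSets, List.mem_cons, List.not_mem_nil, or_false] at hD
  rcases hD with rfl | rfl | rfl | rfl | rfl
  · exact totallyDisconnectedSpace_of_isLabelling (S := {(0, 0)}) (b := 0) (c := 0) (by norm_num)
      (by decide) (by decide +kernel) (by decide +kernel)
  · exact totallyDisconnectedSpace_of_isLabelling (S := {(-1, 0), (0, 0), (1, 0)})
      (b := !![0, 0, 0; 0, -1, 0; 1, 0, 0]) (c := 0) (by norm_num)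
      (by decide) (by decide +kernel) (by decide +kernel)
  · exact totallyDisconnectedSpace_of_isLabelling
      (S := {(-1, 0), (0, -1), (0, 0), (0, 1), (1, 0)}) (b := !![0, 0, 0; -1, 0, -1; 0, 1, 0])
      (c := !![0, -1, 0; 0, 0, 1; 0, -1, 0]) (by norm_num)
      (by decide) (by decide +kernel) (by decide +kernel)
  · exact totallyDisconnectedSpace_of_isLabelling
      (S := {(-1, -1), (0, -1), (0, 0), (0, 1), (1, 1)}) (b := !![0, 0, 0; -1, 0, -1; 0, 0, 1])
      (c := !![0, -1, 0; -3, 0, -2; 0, 0, 1]) (by norm_num)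
      (by decide) (by decide +kernel) (by decide +kernel)
  · exact totallyDisconnectedSpace_of_isLabelling_of_column
      (S := {(-1, -1), (-1, 0), (0, -1), (0, 0), (0, 1), (1, 0), (1, 1)})
      (c := !![0, -1, 0; 0, 0, -1; -1, 0, 0]) (i := 1) (j := 2) (by norm_num)
      (by decide) (by decide +kernel) (by decide) (by decide)

theorem preconnectedSpace_of_mem_connectedSets {D : Finset (Fin 3 × Fin 3)}
    (hD : D ∈ connectedSets) : PreconnectedSpace (fractalSquare 3 D) := by
  have h : ∀ E ∈ connectedSets, E.Nonempty ∧ HasConnectedDigits E := by decide +kernel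
  obtain ⟨hne, hconn⟩ := h D hD
  exact isPreconnected_iff_preconnectedSpace.1
    ((isFractalSquare_fractalSquare 3 (by norm_num) D hne).isPreconnected (by norm_num) hconn)

theorem nonempty_homeomorph_of_mem_rowSets {D E : Finset (Fin 3 × Fin 3)} (hD : D ∈ rowSets)
    (hE : E ∈ rowSets) : Nonempty (fractalSquare 3 D ≃ₜ fractalSquare 3 E) := by
  have hne : ∀ D ∈ rowSets, D.Nonempty := by decide +kernel
  exact (isDecorated_of_mem_rowSets hD).nonempty_homeomorph_fractalSquare (by norm_num) (hne D hD)
    (hne E hE) (isDecorated_of_mem_rowSets hE)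

theorem nonempty_homeomorph_of_mem_cantorSets {D E : Finset (Fin 3 × Fin 3)} (hD : D ∈ cantorSets)
    (hE : E ∈ cantorSets) : Nonempty (fractalSquare 3 D ≃ₜ fractalSquare 3 E) := by
  have hcard : ∀ D ∈ cantorSets, 1 < D.card := by decide +kernel
  have hnontrivial : ∀ D ∈ cantorSets, D.Nontrivial := fun D hD =>
    Finset.one_lt_card_iff_nontrivial.1 (hcard D hD)
  have hdecorated : ∀ D ∈ cantorSets, IsDecorated Unit (fractalSquare 3 D) := fun D hD => by
    have := totallyDisconnectedSpace_of_mem_cantorSets hD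
    have hK := isFractalSquare_fractalSquare 3 (by norm_num) D (hnontrivial D hD).nonempty
    exact hK.isDecorated_unit (by norm_num) (hnontrivial D hD)
  exact (hdecorated D hD).nonempty_homeomorph_fractalSquare (by norm_num)
    (hnontrivial D hD).nonempty (hnontrivial E hE).nonempty (hdecorated E hE)

theorem exists_homeomorph_topologicalRepresentative {D : Finset (Fin 3 × Fin 3)}
    (hD : D.card = 5) :
    ∃ E ∈ topologicalRepresentatives, Nonempty (fractalSquare 3 D ≃ₜ fractalSquare 3 E) := by
  obtain ⟨E, hE, ⟨f⟩⟩ := exists_homeomorph_affineRepresentative hD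
  simp only [affineRepresentatives, List.mem_append, List.mem_singleton] at hE
  rcases hE with ((hE | hE) | hE) | rfl
  · obtain ⟨g⟩ := nonempty_homeomorph_of_mem_rowSets hE (E := D4) (by decide)
    exact ⟨D4, by decide, ⟨f.trans g⟩⟩
  · obtain ⟨g⟩ := nonempty_homeomorph_of_mem_cantorSets hE List.mem_cons_self
    exact ⟨_, by decide, ⟨f.trans g⟩⟩
  · exact ⟨E, List.mem_append_left _ hE, ⟨f⟩⟩
  · exact ⟨D6, by decide, ⟨f⟩⟩

theorem chi_le_length {q : ℕ} {L : List (Finset (Fin 3 × Fin 3))} (hL : ∀ E ∈ L, E.card = q)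
    (h : ∀ D : Finset (Fin 3 × Fin 3), D.card = q →
      ∃ E ∈ L, Nonempty (fractalSquare 3 D ≃ₜ fractalSquare 3 E)) : chi q ≤ L.length := by
  let f (n : Fin L.length) : Quotient (topEquiv (orderThreeFamily q)) :=
    ⟦⟨fractalSquare 3 L[n], L[n], hL _ (List.getElem_mem n.isLt), rfl⟩⟧
  have hf : Function.Surjective f := by
    refine Quotient.ind ?_
    rintro ⟨_, D, hD, rfl⟩
    obtain ⟨E, hE, ⟨g⟩⟩ := h D hD
    obtain ⟨n, hn, rfl⟩ := List.getElem_of_mem hE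
    exact ⟨⟨n, hn⟩, Quotient.sound ⟨g.symm⟩⟩
  simpa [chi] using ENat.card_le_card_of_injective (Function.injective_surjInv hf)

theorem not_hasPointComponent {K : Set Plane} [PreconnectedSpace K] (hn : K.Nontrivial) :
    ¬ HasPointComponent K := by
  rintro ⟨x, hx, h⟩
  have hK : IsPreconnected K := isPreconnected_iff_preconnectedSpace.2 inferInstance
  have hsub := hK.subset_connectedComponentIn hx Subset.rfl
  rw [h] at hsub
  exact hn.not_subset_singleton hsub

theorem not_hasSegmentComponent {K : Set Plane} [TotallyDisconnectedSpace K] :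
    ¬ HasSegmentComponent K := by
  rintro ⟨x, _, a, b, hab, h⟩
  have hK : IsTotallyDisconnected K := totallyDisconnectedSpace_subtype_iff.1 inferInstance
  have hs := hK _ (connectedComponentIn_subset K x) isPreconnected_connectedComponentIn
  rw [h] at hs
  exact hab (hs (left_mem_segment ℝ a b) (right_mem_segment ℝ a b))

end Classification

theorem mainTheorem2 :
    (∀ D : Finset (Fin 3 × Fin 3), D.card = 5 →
      HasPointComponent (fractalSquare 3 D) → HasSegmentComponent (fractalSquare 3 D) →
      ∃ E : Finset (Fin 3 × Fin 3), (E = D4 ∨ E = D5 ∨ E = D6 ∨ E = D7) ∧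
        Nonempty (fractalSquare 3 D ≃ₜ fractalSquare 3 E)) ∧
    chi 5 ≤ 8 := by
  refine ⟨fun D hD hpoint hsegment => ?_, chi_le_length (L := topologicalRepresentatives)
    (by decide +kernel) fun _ => exists_homeomorph_topologicalRepresentative⟩
  obtain ⟨E, hE, ⟨f⟩⟩ := exists_homeomorph_affineRepresentative hD
  simp only [affineRepresentatives, List.mem_append, List.mem_singleton] at hE
  rcases hE with ((hrow | hcantor) | hconnected) | rfl
  · obtain ⟨g⟩ := nonempty_homeomorph_of_mem_rowSets hrow (E := D4) (by decide)
    exact ⟨D4, .inl rfl, ⟨f.trans g⟩⟩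
  · have := totallyDisconnectedSpace_of_mem_cantorSets hcantor
    have := f.symm.totallyDisconnectedSpace
    exact absurd hsegment not_hasSegmentComponent
  · have := preconnectedSpace_of_mem_connectedSets hconnected
    have := f.symm.surjective.denseRange.preconnectedSpace f.symm.continuous
    have hDn : D.Nontrivial := Finset.one_lt_card_iff_nontrivial.1 (by omega)
    have hK := isFractalSquare_fractalSquare 3 (by norm_num) D hDn.nonempty
    exact absurd hpoint (not_hasPointComponent (hK.nontrivial (by norm_num) hDn))
  · exact ⟨D6, .inr (.inr (.inl rfl)), ⟨f⟩⟩
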